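/- Let $q\ge 1$ and let $V_q:\mathbb{Z}\to\mathbb{R}$ satisfy $V_q(n+q)=V_q(n)$ for all $n$. Let $H_q$ be the periodic Schrödinger operator $(H_q\psi)(n)=\psi(n-1)+\psi(n+1)+V_q(n)\psi(n)$ on $\ell^2(\mathbb{Z})$, with canonical basis $(\delta_n)_{n\in\mathbb{Z}}$. For $T>0$ and $n\in\mathbb{Z}$ put $$P_{q,T}(n)=\frac{2}{T}\int_0^\infty\left(|\langle\delta_n,e^{-itH_q}\delta_0\rangle|^2+|\langle\delta_{n+1},e^{-itH_q}\delta_1\rangle|^2\right)e^{-2t/T}\,dt .$$ For $\varkappa\in\mathbb{R}$ let $A_q(\varkappa)$ be the Floquet matrix, that is, the Hermitian $q\times q$ matrix with rows and columns indexed by $0,\dots,q-1$ that is the sum of the diagonal matrix with entries $V_q(0),\dots,V_q(q-1)$, of the matrix with entries $1$ at the positions $(l,l+1)$ and $(l+1,l)$ for $0\le l\le q-2$, and of the matrix with entry $e^{iq\varkappa}$ added at position $(0,q-1)$ and entry $e^{-iq\varkappa}$ added at position $(q-1,0)$ (for $q=1,2$ overlapping entries are added). Let $\lambda_1(\varkappa)\le\dots\le\lambda_q(\varkappa)$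 be its eigenvalues, with orthonormal eigenvectors $\Psi^{(1)}_\varkappa,\dots,\Psi^{(q)}_\varkappa$, and put $\varphi_j(\varkappa)=|\langle\Psi^{(j)}_\varkappa,e_0\rangle|^2+|\langle\Psi^{(j)}_\varkappa,e_1\rangle|^2$, where $e_0,\dots,e_{q-1}$ is the canonical basis of $\mathbb{C}^q$ (with $e_1:=e_0$ if $q=1$). Let $$\mu_{\varkappa,q}=\sum_{j=1}^q\varphi_j(\varkappa)\,\delta_{\lambda_j(\varkappa)},\qquad B_q^{(j)}=\{\lambda_j(\varkappa):\varkappa\in[0,\pi/q]\},\qquad \ell_j=|\lambda_j(\pi/q)-\lambda_j(0)|$$ be the canonical spectral measure of $A_q(\varkappa)$, the bands of the spectrum of $H_q$, and the bandwidths, where $\delta_\lambda$ is the Dirac measure at $\lambda$. There exist absolute constants $0<c,c_1,C<\infty$ such that the following holds for every $q\ge1$, every such $V_q$, every interval $I\subset\mathbb{R}$ and every $\eta>0$: if $$\inf_{\varkappa\in[0,\pi/q]}\mu_{\varkappa,q}(I)>\eta,$$ then there is a $j\in\{1,\dots,q\}$ with $B_q^{(j)}\cap I\ne\varnothing$ and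 $\ell_j>0$ such that for every $T>\frac{C}{c_1}\eta^{-2}q^8\ell_j^{-2}+1$ and every integer $n$ with $$C\eta^{-1}q^4\ell_j^{-1}<n<c_1\eta q^{-4}\ell_jT$$ one has $$P_{q,T}(nq)>\frac{c\,\eta^2}{q^6\,\ell_j\,T}.$$ -/

import Mathlib

noncomputable section

namespace PeriodicSchrodinger

/-- The complex Hilbert space `ℓ²(ℤ)`. -/
abbrev L2Z : Type := lp (fun _ : ℤ => ℂ) 2

/-- The canonical basis vector `δ_n` of `ℓ²(ℤ)`. -/
def delta (n : ℤ) : L2Z := lp.single 2 n (1 : ℂ)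

theorem memlp_shift (a : ℤ) (ψ : L2Z) :
    Memℓp (E := fun _ : ℤ => ℂ) (fun n => ψ (n + a)) 2 := by
  have h2 : 0 < (2 : ENNReal).toReal := by norm_num
  exact memℓp_gen (((lp.memℓp ψ).summable h2).comp_injective (add_left_injective a))

/-- The translation `(S_a ψ)(n) = ψ(n + a)` on `ℓ²(ℤ)`. -/
def shift (a : ℤ) : L2Z →L[ℂ] L2Z :=
  LinearMap.mkContinuous
    { toFun := fun ψ => ⟨fun n => ψ (n + a), memlp_shift a ψ⟩
      map_add' := fun _ _ => rfl
      map_smul' := fun _ _ => rfl } 1 (by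
    intro ψ
    have h2 : 0 < (2 : ENNReal).toReal := by norm_num
    rw [one_mul]
    refine lp.norm_le_of_tsum_le h2 (norm_nonneg _) ?_
    rw [lp.norm_rpow_eq_tsum h2 ψ]
    exact ((Equiv.addRight a).tsum_eq (fun n => ‖ψ n‖ ^ (2 : ENNReal).toReal)).le)

theorem memlp_mul (V : ℤ → ℝ) (hV : ∃ C, ∀ n, |V n| ≤ C) (ψ : L2Z) :
    Memℓp (E := fun _ : ℤ => ℂ) (fun n => (V n : ℂ) * ψ n) 2 := by
  obtain ⟨C, hC⟩ := hV
  refine ((lp.memℓp ψ).const_smul (C : ℂ)).mono' fun n => ?_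
  have h0 : 0 ≤ C := (abs_nonneg _).trans (hC 0)
  simp only [Pi.smul_apply, norm_mul, Complex.norm_real, Real.norm_eq_abs, smul_eq_mul,
    abs_of_nonneg h0]
  exact mul_le_mul_of_nonneg_right (hC n) (norm_nonneg _)

/-- Multiplication by a bounded real potential, `(V ψ)(n) = V(n) ψ(n)`, on `ℓ²(ℤ)`. -/
def potentialOp (V : ℤ → ℝ) (hV : ∃ C, ∀ n, |V n| ≤ C) : L2Z →L[ℂ] L2Z :=
  LinearMap.mkContinuousOfExistsBound
    { toFun := fun ψ => ⟨fun n => (V n : ℂ) * ψ n, memlp_mul V hV ψ⟩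
      map_add' := fun ψ φ => by
        ext n
        exact mul_add _ _ _
      map_smul' := fun c ψ => by
        ext n
        exact mul_left_comm _ _ _ } (by
    obtain ⟨C, hC⟩ := hV
    have h0 : 0 ≤ C := (abs_nonneg _).trans (hC 0)
    refine ⟨C, fun ψ => ?_⟩
    have h1 : ‖(C : ℂ) • ψ‖ = C * ‖ψ‖ := by
      rw [norm_smul, Complex.norm_real, Real.norm_of_nonneg h0]
    rw [← h1]
    refine lp.norm_mono (by norm_num) fun n => ?_
    change ‖(V n : ℂ) * ψ n‖ ≤ ‖(C : ℂ) * ψ n‖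
    rw [norm_mul, norm_mul, Complex.norm_real, Complex.norm_real, Real.norm_eq_abs,
      Real.norm_of_nonneg h0]
    exact mul_le_mul_of_nonneg_right (hC n) (norm_nonneg _))

/-- The bounded discrete Schrödinger operator
`(H ψ)(n) = ψ(n - 1) + ψ(n + 1) + V(n) ψ(n)` on `ℓ²(ℤ)`. -/
def schrodinger (V : ℤ → ℝ) (hV : ∃ C, ∀ n, |V n| ≤ C) : L2Z →L[ℂ] L2Z :=
  shift (-1) + shift 1 + potentialOp V hV

theorem schrodinger_apply (V : ℤ → ℝ) (hV : ∃ C, ∀ n, |V n| ≤ C) (ψ : L2Z) (n : ℤ) :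
    schrodinger V hV ψ n = ψ (n - 1) + ψ (n + 1) + (V n : ℂ) * ψ n := rfl

theorem periodic_bounded {V : ℤ → ℝ} {q : ℕ} [NeZero q] (hV : Function.Periodic V (q : ℤ)) :
    ∃ C, ∀ n, |V n| ≤ C := by
  have hq : (0 : ℤ) < q := by exact_mod_cast Nat.pos_of_ne_zero (NeZero.ne q)
  refine ⟨∑ m ∈ Finset.Ico (0 : ℤ) q, |V m|, fun n => ?_⟩
  obtain ⟨m, hm, hmn⟩ := hV.exists_mem_Ico₀ hq n
  rw [hmn]
  exact Finset.single_le_sum (f := fun m => |V m|) (fun _ _ => abs_nonneg _)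
    (Finset.mem_Ico.mpr hm)

/-- The periodic Schrödinger operator `H_q = Δ + V_q`, where `V_q` has period `q ≥ 1`. -/
def periodicOp (q : ℕ) [NeZero q] (V : ℤ → ℝ) (hV : Function.Periodic V (q : ℤ)) :
    L2Z →L[ℂ] L2Z :=
  schrodinger V (periodic_bounded hV)

/-- The propagator `e^{-itH}` of a bounded operator `H`. -/
def propagator (H : L2Z →L[ℂ] L2Z) (t : ℝ) : L2Z →L[ℂ] L2Z :=
  NormedSpace.exp ((-Complex.I * (t : ℂ)) • H)

/-- The Abel-averaged probability
`P_T(n) = (2/T) ∫₀^∞ (|⟨δ_n, e^{-itH} δ_0⟩|² + |⟨δ_{n+1}, e^{-itH} δ_1⟩|²) e^{-2t/T} dt`. -/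
def abelProb (H : L2Z →L[ℂ] L2Z) (T : ℝ) (n : ℤ) : ℝ :=
  2 / T * ∫ t in Set.Ioi (0 : ℝ),
    (‖inner ℂ (delta n) (propagator H t (delta 0))‖ ^ 2
      + ‖inner ℂ (delta (n + 1)) (propagator H t (delta 1))‖ ^ 2) * Real.exp (-2 * t / T)

/-- The Floquet matrix `A_q(κ)`, on the period block of sites `0, …, q - 1`. The hopping and corner
entries are added up, so that they overlap correctly for `q = 1` and `q = 2`. -/
def floquet (q : ℕ) (V : ℤ → ℝ) (κ : ℝ) : Matrix (Fin q) (Fin q) ℂ :=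
  Matrix.of fun l m =>
    (if l = m then (V (l : ℕ) : ℂ) else 0)
    + (if (l : ℕ) + 1 = m then 1 else 0)
    + (if (m : ℕ) + 1 = l then 1 else 0)
    + (if (l : ℕ) = 0 ∧ (m : ℕ) + 1 = q then Complex.exp (Complex.I * (q * κ : ℝ)) else 0)
    + (if (m : ℕ) = 0 ∧ (l : ℕ) + 1 = q then Complex.exp (-(Complex.I * (q * κ : ℝ))) else 0)

theorem floquet_isHermitian (q : ℕ) (V : ℤ → ℝ) (κ : ℝ) : (floquet q V κ).IsHermitian := by
  have e1 : star (Complex.exp (Complex.I * (q * κ : ℝ)))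
      = Complex.exp (-(Complex.I * (q * κ : ℝ))) := by
    rw [Complex.star_def, ← Complex.exp_conj, map_mul, Complex.conj_I, Complex.conj_ofReal,
      neg_mul]
  have e2 : star (Complex.exp (-(Complex.I * (q * κ : ℝ))))
      = Complex.exp (Complex.I * (q * κ : ℝ)) := by
    rw [← e1, star_star]
  ext l m
  simp only [Matrix.conjTranspose_apply, floquet, Matrix.of_apply, star_add, apply_ite star,
    star_zero, star_one, e1, e2, Complex.star_def, Complex.conj_ofReal]
  rcases eq_or_ne l m with rfl | h
  · simp only [if_true]
    ring
  · simp only [h, h.symm, if_false]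
    ring

/-- The index `0, …, q - 1` counted from the right, as an index for Mathlib's decreasing
enumeration of eigenvalues. -/
def revIndex {q : ℕ} (j : Fin q) : Fin (Fintype.card (Fin q)) :=
  Fin.cast (Fintype.card_fin q).symm j.rev

/-- The `j`-th eigenvalue `λ_j(κ)` of the Floquet matrix, in increasing order with multiplicity. -/
def eigval (q : ℕ) (V : ℤ → ℝ) (j : Fin q) (κ : ℝ) : ℝ :=
  (floquet_isHermitian q V κ).eigenvalues₀ (revIndex j)

/-- A normalized eigenvector `Ψ_κ^{(j)}` of the Floquet matrix for the eigenvalue `λ_j(κ)`. -/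
def eigvec (q : ℕ) (V : ℤ → ℝ) (j : Fin q) (κ : ℝ) : EuclideanSpace ℂ (Fin q) :=
  (floquet_isHermitian q V κ).eigenvectorBasis
    (Fintype.equivOfCardEq (Fintype.card_fin _) (revIndex j))

theorem eigval_monotone (q : ℕ) (V : ℤ → ℝ) (κ : ℝ) : Monotone fun j => eigval q V j κ :=
  fun _ _ hij => (floquet_isHermitian q V κ).eigenvalues₀_antitone (Fin.rev_le_rev.mpr hij)

theorem floquet_mulVec_eigvec (q : ℕ) (V : ℤ → ℝ) (j : Fin q) (κ : ℝ) :
    (floquet q V κ).mulVec (eigvec q V j κ) = eigval q V j κ • ⇑(eigvec q V j κ) := by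
  have h := (floquet_isHermitian q V κ).mulVec_eigenvectorBasis
    (Fintype.equivOfCardEq (Fintype.card_fin _) (revIndex j))
  rw [Matrix.IsHermitian.eigenvalues, Equiv.symm_apply_apply] at h
  exact h

theorem eigvec_orthonormal (q : ℕ) (V : ℤ → ℝ) (κ : ℝ) :
    Orthonormal ℂ fun j => eigvec q V j κ := by
  refine (floquet_isHermitian q V κ).eigenvectorBasis.orthonormal.comp _ ?_
  refine (Equiv.injective _).comp fun i j h => ?_
  exact Fin.rev_injective (Fin.cast_injective _ h)

/-- `φ_j(κ) = |⟨Ψ_κ^{(j)}, e_0⟩|² + |⟨Ψ_κ^{(j)}, e_1⟩|²`; the index `1` is read modulo `q`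
(this matters only for `q = 1`). -/
def weight (q : ℕ) [NeZero q] (V : ℤ → ℝ) (j : Fin q) (κ : ℝ) : ℝ :=
  ‖inner ℂ (eigvec q V j κ) (EuclideanSpace.single (0 : Fin q) (1 : ℂ))‖ ^ 2
    + ‖inner ℂ (eigvec q V j κ) (EuclideanSpace.single (1 : Fin q) (1 : ℂ))‖ ^ 2

/-- The canonical spectral measure `μ_{κ,q} = ∑_j φ_j(κ) δ_{λ_j(κ)}` of the Floquet matrix. -/
def floquetMeasure (q : ℕ) [NeZero q] (V : ℤ → ℝ) (κ : ℝ) : MeasureTheory.Measure ℝ :=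
  ∑ j : Fin q, ENNReal.ofReal (weight q V j κ) • MeasureTheory.Measure.dirac (eigval q V j κ)

/-- The `j`-th band `B_q^{(j)} = {λ_j(κ) : κ ∈ [0, π/q]}`. -/
def band (q : ℕ) (V : ℤ → ℝ) (j : Fin q) : Set ℝ :=
  eigval q V j '' Set.Icc 0 (Real.pi / q)

/-- The bandwidth `ℓ_j = |B_q^{(j)}| = |λ_j(π/q) - λ_j(0)|`. -/
def bandwidth (q : ℕ) (V : ℤ → ℝ) (j : Fin q) : ℝ :=
  |eigval q V j (Real.pi / q) - eigval q V j 0|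

end PeriodicSchrodinger

end

/-! By Plancherel in time, the averaged probability is `(πT)⁻¹` times the energy integral of
`|G(nq,0;z)|² + |G(nq+1,1;z)|²` at `z = E + i/T` (`abelProb_eq`). So it suffices to bound the Green
function `G` from below on part of one band.

Let `Δ` be the discriminant and `ρ + ρ⁻¹ = Δ(z)` with `|ρ| ≤ 1`. Past its source the Green function
is a decaying solution of the periodic equation, hence `G(k+Nq,k) = ρ^N G(k,k)`, and both factors
need a lower bound at `z = λ_j(κ) + iε`, `ε = 1/T`.

The power: `Δ` is a polynomial of degree `q` bounded by `2` on the band of length `ℓ`, so a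
Markov-type inequality gives `|Δ(z) - 2 cos qκ| ≤ 96 q² ε / ℓ`. Hence `ρ` is within `96 q² ε / (ℓ
sin qκ)` of `e^{iqκ}` or `e^{-iqκ}`, and if `sin qκ ≥ 1/(2q)` then `|ρ|^N ≥ 1/2` for all `N` up to
order `ℓT/q⁴` (`multiplier_bounds`).

The diagonal: the Bloch sum of `G(·,k)` is a column of the resolvent of the Floquet matrix, and
summing `ζⁿρ^{|n|}` shows that its diagonal entry times `Δ(z) - 2 cos qκ` has modulus `|G(k,k)| |ρ⁻¹
- ρ|`. The resolvent entry is at least `|⟨Ψ,e⟩|²/ε`, and `|Δ(z) - 2 cos qκ| ≥ ε|Δ'(λ_j)|` because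
all zeros of `Δ - 2 cos qκ` are real. The `ε` cancels (`SolvesWithSource.green_lower_bound`). With
the quasimomentum `k(E)`, `|Δ'| ≥ 2q sin(qκ)|k'|`, while `|ρ⁻¹ - ρ| ≤ 5 sin qκ`; the sines cancel
too, and where `φ_j ≥ η/q` the energy density is at least `(η²/50) k'(E)²`
(`energyDensity_lower_bound`).

Finally, at every `κ` some `j` has `λ_j(κ) ∈ I` and `φ_j(κ) ≥ η/q`. By pigeonhole one `j` serves a
set of `κ` of outer measure at least `π/q²`, of which `π/(2q²)` remains after removing the band
edges (`exists_large_piece`). Cauchy–Schwarz over the band bounds `∫ k'²` below by the square of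
that measure over `ℓ` (`integral_ge_of_image`). -/

open MeasureTheory

namespace PeriodicSchrodinger

/-! ### Plancherel's theorem for Fourier and Laplace transforms -/

section Plancherel

open FourierTransform SchwartzMap

/-- On `L¹ ∩ L²` the `L²` Fourier transform is given by the Fourier integral. -/
theorem coeFn_fourier_toLp_ae {f : ℝ → ℂ} (h1 : Integrable f) (h2 : MemLp f 2) :
    ((𝓕 (h2.toLp f) : Lp ℂ 2 (volume : Measure ℝ)) : ℝ → ℂ) =ᵐ[volume] 𝓕 f := by
  have hcont : Continuous (𝓕 f) :=
    VectorFourier.fourierIntegral_continuous Real.continuous_fourierChar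
      (by exact continuous_inner) h1
  -- Both functions are tested against smooth compactly supported `g`. The `L²` transform is the
  -- distributional one, and for integrable `f` Fubini moves the transform from `g` to `f`.
  refine ae_eq_of_integral_contDiff_smul_eq
    ((Lp.memLp _).locallyIntegrable (by norm_num)) hcont.locallyIntegrable ?_
  intro g hg hgs
  have hg' : ContDiff ℝ (⊤ : ℕ∞) (fun x => (g x : ℂ)) := Complex.ofRealCLM.contDiff.comp hg
  have hgs' : HasCompactSupport (fun x => (g x : ℂ)) :=
    hgs.comp_left (g := fun x : ℝ => (x : ℂ)) Complex.ofReal_zero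
  set φ : 𝓢(ℝ, ℂ) := hgs'.toSchwartzMap hg' with hφ
  have hφx : ∀ x, φ x = (g x : ℂ) := fun x => rfl
  have e := congrArg (fun d => d φ) (Lp.fourier_toTemperedDistribution_eq (h2.toLp f))
  simp only [TemperedDistribution.fourier_apply, Lp.toTemperedDistribution_apply, hφx,
    SchwartzMap.fourier_coe] at e
  have e1 : ∀ F : ℝ → ℂ, ∫ x, g x • F x = ∫ x, (g x : ℂ) • F x := fun F => by
    simp only [Complex.real_smul, smul_eq_mul]
  rw [e1, e1, ← e]
  have e2 : ∫ x, 𝓕 (⇑φ) x • ((h2.toLp f : Lp ℂ 2 (volume : Measure ℝ)) : ℝ → ℂ) x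
      = ∫ x, 𝓕 (⇑φ) x • f x := by
    refine integral_congr_ae ?_
    filter_upwards [h2.coeFn_toLp] with x hx
    rw [hx]
  rw [e2]
  have e3 := VectorFourier.integral_fourierIntegral_smul_eq_flip (μ := (volume : Measure ℝ))
    (ν := (volume : Measure ℝ)) (L := innerₗ ℝ) Real.continuous_fourierChar
    (by exact continuous_inner) (φ.integrable (μ := volume)) h1
  rw [flip_innerₗ] at e3
  exact e3

theorem memLp_fourier {f : ℝ → ℂ} (h1 : Integrable f) (h2 : MemLp f 2) : MemLp (𝓕 f) 2 :=
  (memLp_congr_ae (coeFn_fourier_toLp_ae h1 h2)).mp (Lp.memLp _)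

/-- **Plancherel's theorem** on `L¹ ∩ L²`. -/
theorem integral_norm_sq_fourier {f : ℝ → ℂ} (h1 : Integrable f) (h2 : MemLp f 2) :
    ∫ w, ‖𝓕 f w‖ ^ 2 = ∫ t, ‖f t‖ ^ 2 := by
  have key : ∀ g : Lp ℂ 2 (volume : Measure ℝ), ∫ x, ‖g x‖ ^ 2 = ‖g‖ ^ 2 := fun g => by
    have := congrArg Complex.re (L2.inner_def (𝕜 := ℂ) g g)
    rw [inner_self_eq_norm_sq_to_K] at this
    have h3 : ∀ x, inner ℂ (g x) (g x) = ((‖g x‖ ^ 2 : ℝ) : ℂ) := fun x => by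
      rw [inner_self_eq_norm_sq_to_K]; norm_cast
    simp only [h3] at this
    rw [integral_complex_ofReal] at this
    exact_mod_cast this.symm
  have hl : ∫ w, ‖𝓕 f w‖ ^ 2
      = ∫ w, ‖(𝓕 (h2.toLp f) : Lp ℂ 2 (volume : Measure ℝ)) w‖ ^ 2 := by
    refine integral_congr_ae ?_
    filter_upwards [coeFn_fourier_toLp_ae h1 h2] with x hx
    rw [hx]
  have hr : ∫ t, ‖f t‖ ^ 2 = ∫ t, ‖(h2.toLp f : Lp ℂ 2 (volume : Measure ℝ)) t‖ ^ 2 := by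
    refine integral_congr_ae ?_
    filter_upwards [h2.coeFn_toLp] with x hx
    rw [hx]
  rw [hl, hr, key, key, Lp.norm_fourier_eq]

end Plancherel

/-- The Laplace transform `∫₀^∞ e^{izt} f(t) dt`. -/
noncomputable def laplace (f : ℝ → ℂ) (z : ℂ) : ℂ :=
  ∫ t in Set.Ioi (0 : ℝ), Complex.exp (Complex.I * z * t) * f t

theorem norm_cexp_I_mul (z : ℂ) (t : ℝ) :
    ‖Complex.exp (Complex.I * z * t)‖ = Real.exp (-z.im * t) := by
  rw [Complex.norm_exp]
  simp

theorem integrableOn_exp_neg_mul {a : ℝ} (ha : 0 < a) :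
    IntegrableOn (fun t => Real.exp (-a * t)) (Set.Ioi 0) :=
  integrableOn_exp_mul_Ioi (by linarith) 0

section LaplacePlancherel

open FourierTransform

variable {f : ℝ → ℂ} {C T : ℝ}

theorem integrable_damped (hf : Continuous f) (hC : ∀ t, ‖f t‖ ≤ C) (hT : 0 < T) :
    Integrable ((Set.Ioi (0 : ℝ)).indicator fun t => ((Real.exp (-T⁻¹ * t) : ℝ) : ℂ) * f t) := by
  rw [integrable_indicator_iff measurableSet_Ioi]
  refine Integrable.mono' ((integrableOn_exp_neg_mul (inv_pos.mpr hT)).mul_const C)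
    (by fun_prop) (Filter.Eventually.of_forall fun t => ?_)
  rw [norm_mul, Complex.norm_real, Real.norm_of_nonneg (Real.exp_pos _).le]
  exact mul_le_mul_of_nonneg_left (hC t) (Real.exp_pos _).le

theorem memLp_two_damped (hf : Continuous f) (hC : ∀ t, ‖f t‖ ≤ C) (hT : 0 < T) :
    MemLp ((Set.Ioi (0 : ℝ)).indicator fun t => ((Real.exp (-T⁻¹ * t) : ℝ) : ℂ) * f t) 2 := by
  rw [memLp_indicator_iff_restrict measurableSet_Ioi,
    memLp_two_iff_integrable_sq_norm (by fun_prop)]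
  refine Integrable.mono' ((integrableOn_exp_neg_mul
    (show 0 < 2 * T⁻¹ by positivity)).mul_const (C ^ 2)) (by fun_prop)
    (Filter.Eventually.of_forall fun t => ?_)
  rw [norm_mul, Complex.norm_real, Real.norm_of_nonneg (Real.exp_pos _).le, Real.norm_of_nonneg
    (by positivity), mul_pow, ← Real.exp_nat_mul]
  have e : Real.exp ((2 : ℕ) * (-T⁻¹ * t)) = Real.exp (-(2 * T⁻¹) * t) := by
    congr 1; push_cast; ring
  rw [e]
  exact mul_le_mul_of_nonneg_left (pow_le_pow_left₀ (norm_nonneg _) (hC t) 2) (Real.exp_pos _).le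

/-- The imaginary part `1/T` of the energy becomes the damping `e^{-t/T}`. The frequency is
`-E/(2π)` because the Fourier kernel is `e^{-2πitw}`; this rescaling produces the factor `2π` in
`integral_norm_sq_laplace`. -/
theorem laplace_eq_fourier (E : ℝ) :
    laplace f (E + Complex.I * (T⁻¹ : ℝ)) =
      𝓕 ((Set.Ioi (0 : ℝ)).indicator fun t => ((Real.exp (-T⁻¹ * t) : ℝ) : ℂ) * f t)
        (E * (-(2 * Real.pi)⁻¹)) := by
  rw [Real.fourier_real_eq, laplace, ← integral_indicator measurableSet_Ioi]
  refine integral_congr_ae (Filter.Eventually.of_forall fun t => ?_)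
  by_cases ht : t ∈ Set.Ioi (0 : ℝ)
  · simp only [Set.indicator_of_mem ht, Circle.smul_def, Real.fourierChar_apply, smul_eq_mul]
    rw [← mul_assoc, Complex.ofReal_exp, ← Complex.exp_add]
    congr 2
    have hpi : (Real.pi : ℂ) ≠ 0 := by exact_mod_cast Real.pi_ne_zero
    push_cast
    field_simp
    ring_nf
    rw [Complex.I_sq]
    ring
  · simp [Set.indicator_of_notMem ht]

theorem integrable_norm_sq_laplace (hf : Continuous f) (hC : ∀ t, ‖f t‖ ≤ C) (hT : 0 < T) :
    Integrable fun E : ℝ => ‖laplace f (E + Complex.I * (T⁻¹ : ℝ))‖ ^ 2 := by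
  have h := (memLp_two_iff_integrable_sq_norm (memLp_fourier (integrable_damped hf hC hT)
    (memLp_two_damped hf hC hT)).1).mp
    (memLp_fourier (integrable_damped hf hC hT) (memLp_two_damped hf hC hT))
  have hpi : -(2 * Real.pi)⁻¹ ≠ 0 := by
    have := Real.pi_pos; exact neg_ne_zero.mpr (by positivity)
  simp_rw [laplace_eq_fourier]
  exact h.comp_mul_right' hpi

theorem continuous_laplace (hf : Continuous f) (hC : ∀ t, ‖f t‖ ≤ C) (hT : 0 < T) :
    Continuous fun E : ℝ => laplace f (E + Complex.I * (T⁻¹ : ℝ)) := by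
  simp_rw [laplace_eq_fourier]
  have := VectorFourier.fourierIntegral_continuous Real.continuous_fourierChar
      (L := innerₗ ℝ) (by exact continuous_inner) (integrable_damped hf hC hT)
  exact Continuous.comp (g := 𝓕 _) this (by fun_prop)

theorem integral_norm_sq_laplace (hf : Continuous f) (hC : ∀ t, ‖f t‖ ≤ C) (hT : 0 < T) :
    ∫ E : ℝ, ‖laplace f (E + Complex.I * (T⁻¹ : ℝ))‖ ^ 2 =
      2 * Real.pi * ∫ t in Set.Ioi (0 : ℝ), ‖f t‖ ^ 2 * Real.exp (-2 * t / T) := by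
  have h := integral_norm_sq_fourier (integrable_damped hf hC hT) (memLp_two_damped hf hC hT)
  simp_rw [laplace_eq_fourier]
  rw [Measure.integral_comp_mul_right (fun w => ‖𝓕 ((Set.Ioi (0 : ℝ)).indicator
    fun t => ((Real.exp (-T⁻¹ * t) : ℝ) : ℂ) * f t) w‖ ^ 2) (-(2 * Real.pi)⁻¹), h]
  have hpi := Real.pi_pos
  rw [smul_eq_mul, inv_neg, inv_inv, abs_neg, abs_of_pos (by positivity),
    ← integral_indicator measurableSet_Ioi]
  congr 1
  refine integral_congr_ae (Filter.Eventually.of_forall fun t => ?_)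
  by_cases ht : t ∈ Set.Ioi (0 : ℝ)
  · simp only [Set.indicator_of_mem ht]
    rw [norm_mul, Complex.norm_real, Real.norm_of_nonneg (Real.exp_pos _).le, mul_pow,
      ← Real.exp_nat_mul, mul_comm]
    congr 2
    push_cast
    field_simp
  · simp [Set.indicator_of_notMem ht]

end LaplacePlancherel

end PeriodicSchrodinger


/-! ### Joukowski coordinates and a Markov-type inequality -/

namespace PeriodicSchrodinger

/-- The two roots of `ρ² - Dρ + 1` have product `1`, so one of them lies in the closed unit disc. -/
theorem exists_add_inv_eq (D : ℂ) : ∃ ρ : ℂ, ρ ≠ 0 ∧ ‖ρ‖ ≤ 1 ∧ ρ + ρ⁻¹ = D := by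
  obtain ⟨s, hs⟩ := IsAlgClosed.exists_pow_nat_eq (D ^ 2 - 4) (n := 2) (by norm_num)
  have hr : (D + s) / 2 * ((D - s) / 2) = 1 := by linear_combination -hs / 4
  have h0 : (D + s) / 2 ≠ 0 := left_ne_zero_of_mul_eq_one hr
  have hi : ((D + s) / 2)⁻¹ = (D - s) / 2 := inv_eq_of_mul_eq_one_right hr
  rcases le_total ‖(D + s) / 2‖ 1 with h | h
  · exact ⟨_, h0, h, by rw [hi]; ring⟩
  · refine ⟨((D + s) / 2)⁻¹, inv_ne_zero h0, ?_, by rw [inv_inv, hi]; ring⟩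
    rw [norm_inv]
    exact inv_le_one_of_one_le₀ h

theorem sub_mul_sub_inv {ρ ω : ℂ} (hρ : ρ ≠ 0) (hω : ω ≠ 0) :
    (ρ - ω) * (ρ - ω⁻¹) = (ρ + ρ⁻¹ - (ω + ω⁻¹)) * ρ := by
  field_simp
  ring

theorem norm_sub_mul_norm_sub_inv_le {ρ ω : ℂ} (hρ : ρ ≠ 0) (hρ1 : ‖ρ‖ ≤ 1) (hω : ω ≠ 0) :
    ‖ρ - ω‖ * ‖ρ - ω⁻¹‖ ≤ ‖ρ + ρ⁻¹ - (ω + ω⁻¹)‖ := by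
  rw [← norm_mul, sub_mul_sub_inv hρ hω, norm_mul]
  exact mul_le_of_le_one_right (norm_nonneg _) hρ1

theorem exp_I_add_inv (θ : ℝ) :
    Complex.exp (θ * Complex.I) + (Complex.exp (θ * Complex.I))⁻¹ = ((2 * Real.cos θ : ℝ) : ℂ) := by
  rw [← Complex.exp_neg, ← neg_mul]
  push_cast
  rw [Complex.two_cos]

section Markov

open Polynomial

variable {P : ℂ[X]} {q : ℕ} {M : ℝ}

/-- The Bernstein–Walsh estimate, in Joukowski coordinates. -/
theorem norm_eval_joukowski_mul_pow_le (hP : P.natDegree ≤ q)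
    (hM : ∀ x : ℝ, x ∈ Set.Icc (-1 : ℝ) 1 → ‖P.eval (x : ℂ)‖ ≤ M) {w : ℂ} (hw0 : w ≠ 0)
    (hw : ‖w‖ ≤ 1) : ‖P.eval ((w + w⁻¹) / 2)‖ * ‖w‖ ^ q ≤ M := by
  -- The factor `w^q` clears the pole at `0`, so `Q` is entire and the maximum principle on the unit
  -- disc applies. On the circle `(w + w⁻¹)/2 = Re w` lies in `[-1, 1]`.
  set Q : ℂ → ℂ := fun w =>
    ∑ i ∈ Finset.range (q + 1), P.coeff i * ((w ^ 2 + 1) / 2) ^ i * w ^ (q - i) with hQ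
  have hQP : ∀ w : ℂ, w ≠ 0 → Q w = P.eval ((w + w⁻¹) / 2) * w ^ q := by
    intro w hw
    rw [hQ, eval_eq_sum_range' (Nat.lt_succ_of_le hP), Finset.sum_mul]
    refine Finset.sum_congr rfl fun i hi => ?_
    have hi' : i ≤ q := Nat.lt_succ_iff.mp (Finset.mem_range.mp hi)
    have e1 : (w ^ 2 + 1) / 2 = (w + w⁻¹) / 2 * w := by field_simp
    have e2 : w ^ q = w ^ i * w ^ (q - i) := by rw [← pow_add, Nat.add_sub_cancel' hi']
    rw [e1, e2, mul_pow]
    ring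
  rw [← norm_pow, ← norm_mul, ← hQP w hw0]
  have hd : Differentiable ℂ Q := by
    rw [hQ]; fun_prop
  refine Complex.norm_le_of_forall_mem_frontier_norm_le (U := Metric.ball (0 : ℂ) 1)
    Metric.isBounded_ball hd.diffContOnCl (fun v hv => ?_) ?_
  · rw [frontier_ball _ one_ne_zero, mem_sphere_zero_iff_norm] at hv
    have hv0 : v ≠ 0 := norm_ne_zero_iff.mp (by rw [hv]; exact one_ne_zero)
    rw [hQP v hv0, norm_mul, norm_pow, hv, one_pow, mul_one]
    have e : (v + v⁻¹) / 2 = (v.re : ℂ) := by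
      rw [Complex.inv_eq_conj hv, Complex.add_conj]
      push_cast
      ring
    rw [e]
    refine hM _ ?_
    rw [Set.mem_Icc, ← abs_le, ← hv]
    exact Complex.abs_re_le_norm v
  · rw [closure_ball _ one_ne_zero, mem_closedBall_zero_iff]
    exact hw

/-- In Joukowski coordinates a point within `1/(8q²)` of `[-1, 1]` has `|ρ| ≥ 1 - 1/(2q)`, so `|ρ|^q
≥ 1/2` by Bernoulli and the Bernstein–Walsh factor costs at most `2`. -/
theorem norm_eval_le_two_mul_of_near_unit (hq : 1 ≤ q) (hP : P.natDegree ≤ q)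
    (hM : ∀ x : ℝ, x ∈ Set.Icc (-1 : ℝ) 1 → ‖P.eval (x : ℂ)‖ ≤ M) {x : ℝ}
    (hx : x ∈ Set.Icc (-1 : ℝ) 1) {z : ℂ} (hz : ‖z - x‖ ≤ 1 / (8 * q ^ 2)) :
    ‖P.eval z‖ ≤ 2 * M := by
  obtain ⟨ρ, hρ, hρ1, hρz⟩ := exists_add_inv_eq (2 * z)
  set ω := Complex.exp (Real.arccos x * Complex.I) with hω
  have hω0 : ω ≠ 0 := Complex.exp_ne_zero _
  have hω1 : ‖ω‖ = 1 := Complex.norm_exp_ofReal_mul_I _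
  have hsum := exp_I_add_inv (Real.arccos x)
  rw [Real.cos_arccos hx.1 hx.2, ← hω] at hsum
  have hq0 : (0 : ℝ) < q := by exact_mod_cast hq
  have h1 := norm_sub_mul_norm_sub_inv_le hρ hρ1 hω0
  rw [hρz, hsum] at h1
  have h2 : ‖2 * z - ((2 * x : ℝ) : ℂ)‖ ≤ (1 / (2 * q : ℝ)) * (1 / (2 * q)) := by
    have : 2 * z - ((2 * x : ℝ) : ℂ) = 2 * (z - x) := by push_cast; ring
    rw [this, norm_mul, Complex.norm_ofNat]
    calc 2 * ‖z - x‖ ≤ 2 * (1 / (8 * q ^ 2)) := by linarith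
      _ = _ := by field_simp; norm_num
  -- The distances from `ρ` to `ω` and `ω⁻¹` have product at most `(1/(2q))²`, so one of them is at
  -- most `1/(2q)`.
  have h3 : ∃ ω' : ℂ, ‖ω'‖ = 1 ∧ ‖ρ - ω'‖ ≤ 1 / (2 * q : ℝ) := by
    by_contra! h
    have ha := h ω hω1
    have hb := h ω⁻¹ (by rw [norm_inv, hω1, inv_one])
    have := mul_lt_mul'' ha hb (by positivity) (by positivity)
    linarith
  obtain ⟨ω', hω', h4⟩ := h3
  have h5 : 1 - 1 / (2 * q : ℝ) ≤ ‖ρ‖ := by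
    have := norm_sub_norm_le ω' ρ
    rw [norm_sub_rev, hω'] at this
    linarith
  have hq1 : (1 : ℝ) ≤ q := by exact_mod_cast hq
  have h6 : (1 : ℝ) / (2 * q) ≤ 1 / 2 := by
    rw [div_le_div_iff₀ (by positivity) (by norm_num)]; linarith
  have h7 : (1 / 2 : ℝ) ≤ ‖ρ‖ ^ q := by
    have hb := one_add_mul_le_pow (a := -(1 / (2 * q : ℝ))) (by linarith) q
    have he : (1 : ℝ) + q * -(1 / (2 * q)) = 1 / 2 := by field_simp; norm_num
    rw [he] at hb
    refine hb.trans (pow_le_pow_left₀ (by linarith) (by linarith) q)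
  have h8 := norm_eval_joukowski_mul_pow_le hP hM hρ hρ1
  rw [hρz, mul_div_cancel_left₀ _ two_ne_zero] at h8
  nlinarith [norm_nonneg (P.eval z)]

/-- Schwarz's lemma: the disc of radius `1/(8q²)` is mapped into a disc of radius `2M + M` around
the central value, and `3M · 8q² = 24Mq²`. -/
theorem norm_eval_sub_eval_le_of_near_unit (hq : 1 ≤ q) (hP : P.natDegree ≤ q)
    (hM : ∀ x : ℝ, x ∈ Set.Icc (-1 : ℝ) 1 → ‖P.eval (x : ℂ)‖ ≤ M) {x : ℝ}
    (hx : x ∈ Set.Icc (-1 : ℝ) 1) {z : ℂ} (hz : ‖z - x‖ < 1 / (8 * q ^ 2)) :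
    ‖P.eval z - P.eval (x : ℂ)‖ ≤ 24 * M * q ^ 2 * ‖z - x‖ := by
  have hq0 : (0 : ℝ) < q := by exact_mod_cast hq
  have h := Complex.dist_le_div_mul_dist_of_mapsTo_ball (f := fun z => P.eval z) (c := (x : ℂ))
    (R₁ := 1 / (8 * q ^ 2)) (R₂ := 3 * M) (z := z) P.differentiable.differentiableOn
    (fun y hy => ?_) (by rwa [Metric.mem_ball, dist_eq_norm])
  · rw [dist_eq_norm, dist_eq_norm] at h
    refine h.trans_eq ?_
    field_simp
    ring
  · rw [Metric.mem_ball, dist_eq_norm] at hy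
    rw [Metric.mem_closedBall, dist_eq_norm]
    have h1 := norm_eval_le_two_mul_of_near_unit hq hP hM hx hy.le
    have h2 := norm_sub_le (P.eval y) (P.eval (x : ℂ))
    have h3 := hM x hx
    simp only
    linarith

/-- A Markov-type inequality: a polynomial of degree `q` bounded on `[a, b]` is Lipschitz with
constant of order `q² / (b - a)` in complex discs of radius of order `(b - a) / q²`. -/
theorem norm_eval_sub_eval_le_of_near_interval (hq : 1 ≤ q) (hP : P.natDegree ≤ q) {a b : ℝ}
    (hab : a < b) (hM : ∀ x : ℝ, x ∈ Set.Icc a b → ‖P.eval (x : ℂ)‖ ≤ M) {x : ℝ}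
    (hx : x ∈ Set.Icc a b) {z : ℂ} (hz : ‖z - x‖ < (b - a) / (16 * q ^ 2)) :
    ‖P.eval z - P.eval (x : ℂ)‖ ≤ 48 * M * q ^ 2 / (b - a) * ‖z - x‖ := by
  have hq0 : (0 : ℝ) < q := by exact_mod_cast hq
  have hba : 0 < b - a := sub_pos.mpr hab
  set L : ℂ[X] := C (((b - a) / 2 : ℝ) : ℂ) * X + C (((a + b) / 2 : ℝ) : ℂ) with hL
  have hdeg : (P.comp L).natDegree ≤ q := by
    refine natDegree_comp_le.trans ?_
    have : L.natDegree ≤ 1 := natDegree_linear_le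
    nlinarith
  have hev : ∀ y : ℂ, (P.comp L).eval y = P.eval ((((b - a) / 2 : ℝ) : ℂ) * y
      + (((a + b) / 2 : ℝ) : ℂ)) := fun y => by
    rw [eval_comp]; simp [hL]
  have hback : ∀ y : ℂ, (((b - a) / 2 : ℝ) : ℂ) * ((y - (((a + b) / 2 : ℝ) : ℂ)) *
      ((2 / (b - a) : ℝ) : ℂ)) + (((a + b) / 2 : ℝ) : ℂ) = y := fun y => by
    have : (((b - a) / 2 : ℝ) : ℂ) * ((2 / (b - a) : ℝ) : ℂ) = 1 := by
      rw [← Complex.ofReal_mul]; norm_cast; field_simp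
    linear_combination (y - (((a + b) / 2 : ℝ) : ℂ)) * this
  set x' : ℝ := (x - (a + b) / 2) * (2 / (b - a)) with hx'
  set z' : ℂ := (z - (((a + b) / 2 : ℝ) : ℂ)) * ((2 / (b - a) : ℝ) : ℂ) with hz'
  have hxx : (((b - a) / 2 : ℝ) : ℂ) * (x' : ℂ) + (((a + b) / 2 : ℝ) : ℂ) = x := by
    rw [← hback x, hx']; push_cast; ring
  have hzx : ‖z' - x'‖ = ‖z - x‖ * (2 / (b - a)) := by
    have : z' - x' = (z - x) * ((2 / (b - a) : ℝ) : ℂ) := by rw [hz', hx']; push_cast; ring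
    rw [this, norm_mul, Complex.norm_real, Real.norm_of_nonneg (by positivity)]
  have hx'm : x' ∈ Set.Icc (-1 : ℝ) 1 := by
    have e : x' = (2 * x - (a + b)) / (b - a) := by rw [hx']; field_simp
    rw [e, Set.mem_Icc, le_div_iff₀ hba, div_le_iff₀ hba]
    constructor <;> linarith [hx.1, hx.2]
  have h := norm_eval_sub_eval_le_of_near_unit (P := P.comp L) (M := M) hq hdeg (fun y hy => ?_)
    hx'm (z := z') (by
      rw [hzx]
      calc ‖z - x‖ * (2 / (b - a)) < (b - a) / (16 * q ^ 2) * (2 / (b - a)) :=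
            mul_lt_mul_of_pos_right hz (by positivity)
        _ = _ := by field_simp; norm_num)
  · rw [hev, hev, hxx, hz', hback, ← hz', hzx] at h
    refine h.trans_eq ?_
    field_simp
    ring
  · rw [hev]
    have : (((b - a) / 2 : ℝ) : ℂ) * (y : ℂ) + (((a + b) / 2 : ℝ) : ℂ)
        = (((b - a) / 2 * y + (a + b) / 2 : ℝ) : ℂ) := by push_cast; ring
    rw [this]
    exact hM _ ⟨by nlinarith [hy.1], by nlinarith [hy.2]⟩

end Markov

end PeriodicSchrodinger


/-! ### Weyl's inequality and continuity of the ordered eigenvalues -/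

namespace PeriodicSchrodinger

section Weyl

variable {E : Type*} [NormedAddCommGroup E] [InnerProductSpace ℂ E] {q : ℕ}

theorem re_inner_map_eq_sum {A : E →ₗ[ℂ] E} (hA : A.IsSymmetric)
    (b : OrthonormalBasis (Fin q) ℂ E) {μ : Fin q → ℝ} (h : ∀ i, A (b i) = (μ i : ℂ) • b i)
    (x : E) : (inner ℂ x (A x)).re = ∑ i, μ i * ‖inner ℂ (b i) x‖ ^ 2 := by
  rw [← b.sum_inner_mul_inner, Complex.re_sum]
  refine Finset.sum_congr rfl fun i _ => ?_
  rw [← hA (b i) x, h i, inner_smul_left, Complex.conj_ofReal, ← inner_conj_symm x (b i),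
    mul_left_comm, ← Complex.normSq_eq_conj_mul_self, ← Complex.ofReal_mul, Complex.ofReal_re,
    Complex.normSq_eq_norm_sq]

/-- Weyl's monotonicity of ordered eigenvalues, in additive form. -/
theorem eigenvalue_le_add_of_form_le {A A' : E →ₗ[ℂ] E} (hA : A.IsSymmetric)
    (hA' : A'.IsSymmetric) (b b' : OrthonormalBasis (Fin q) ℂ E) {μ μ' : Fin q → ℝ}
    (h : ∀ i, A (b i) = (μ i : ℂ) • b i) (h' : ∀ i, A' (b' i) = (μ' i : ℂ) • b' i)
    (hμ : Monotone μ) (hμ' : Monotone μ') {δ : ℝ}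
    (hδ : ∀ x, (inner ℂ x (A x)).re ≤ (inner ℂ x (A' x)).re + δ * ‖x‖ ^ 2) (j : Fin q) :
    μ j ≤ μ' j + δ := by
  have : FiniteDimensional ℂ E := b.toBasis.finiteDimensional_of_finite
  -- Slot `j` is left zero, so `Φ` is not surjective and, by equality of dimensions, not injective.
  -- A nonzero kernel vector is orthogonal to `b i` for `i < j` and to `b' i` for `i > j`, so its
  -- quadratic forms are at least `μ j ‖x‖²` and at most `μ' j ‖x‖²`.
  let Φ : E →ₗ[ℂ] (Fin q → ℂ) := LinearMap.pi fun i =>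
    if i < j then (innerSL ℂ (b i)).toLinearMap
    else if j < i then (innerSL ℂ (b' i)).toLinearMap else 0
  have hΦj : ∀ x, Φ x j = 0 := fun x => by simp [Φ]
  have hΦlt : ∀ x, ∀ i < j, Φ x i = inner ℂ (b i) x := fun x i hi => by simp [Φ, hi]
  have hΦgt : ∀ x i, j < i → Φ x i = inner ℂ (b' i) x := fun x i hi => by
    simp [Φ, hi, not_lt_of_gt hi]
  have hns : ¬ Function.Surjective Φ := fun hs => by
    obtain ⟨x, hx⟩ := hs (Pi.single j 1)
    have := congrFun hx j
    rw [hΦj, Pi.single_eq_same] at this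
    exact zero_ne_one this
  have hni : ¬ Function.Injective Φ := fun hi => hns
    ((LinearMap.injective_iff_surjective_of_finrank_eq_finrank (by
      rw [Module.finrank_eq_card_basis b.toBasis]; simp)).mp hi)
  rw [← LinearMap.ker_eq_bot, ← ne_eq, Submodule.ne_bot_iff] at hni
  obtain ⟨x, hx, hx0⟩ := hni
  have hx' : Φ x = 0 := hx
  have h1 : μ j * ‖x‖ ^ 2 ≤ (inner ℂ x (A x)).re := by
    rw [re_inner_map_eq_sum hA b h, ← b.sum_sq_norm_inner_right x, Finset.mul_sum]
    refine Finset.sum_le_sum fun i _ => ?_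
    rcases lt_or_ge i j with hi | hi
    · rw [← hΦlt x i hi, hx']; simp
    · exact mul_le_mul_of_nonneg_right (hμ hi) (by positivity)
  have h2 : (inner ℂ x (A' x)).re ≤ μ' j * ‖x‖ ^ 2 := by
    rw [re_inner_map_eq_sum hA' b' h', ← b'.sum_sq_norm_inner_right x, Finset.mul_sum]
    refine Finset.sum_le_sum fun i _ => ?_
    rcases lt_or_ge j i with hi | hi
    · rw [← hΦgt x i hi, hx']; simp
    · exact mul_le_mul_of_nonneg_right (hμ' hi) (by positivity)
  have h3 : 0 < ‖x‖ ^ 2 := by have := norm_pos_iff.mpr hx0; positivity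
  have h4 := hδ x
  by_contra! hlt
  nlinarith

end Weyl

/-- The Floquet matrix as an operator on `ℂ^q`. -/
noncomputable def floquetLin (q : ℕ) (V : ℤ → ℝ) (κ : ℝ) :
    EuclideanSpace ℂ (Fin q) →ₗ[ℂ] EuclideanSpace ℂ (Fin q) :=
  Matrix.toEuclideanLin (floquet q V κ)

theorem floquetLin_isSymmetric (q : ℕ) (V : ℤ → ℝ) (κ : ℝ) : (floquetLin q V κ).IsSymmetric :=
  Matrix.isSymmetric_toEuclideanLin_iff.mpr (floquet_isHermitian q V κ)

theorem floquetLin_apply (q : ℕ) (V : ℤ → ℝ) (κ : ℝ) (x : EuclideanSpace ℂ (Fin q)) (l : Fin q) :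
    floquetLin q V κ x l = (floquet q V κ).mulVec x l := rfl

theorem floquetLin_eigvec (q : ℕ) (V : ℤ → ℝ) (j : Fin q) (κ : ℝ) :
    floquetLin q V κ (eigvec q V j κ) = (eigval q V j κ : ℂ) • eigvec q V j κ := by
  ext l
  rw [floquetLin_apply, floquet_mulVec_eigvec]
  simp

/-- The eigenvectors of the Floquet matrix as an orthonormal basis. -/
noncomputable def eigBasis (q : ℕ) (V : ℤ → ℝ) (κ : ℝ) :
    OrthonormalBasis (Fin q) ℂ (EuclideanSpace ℂ (Fin q)) :=
  OrthonormalBasis.mk (eigvec_orthonormal q V κ)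
    ((eigvec_orthonormal q V κ).linearIndependent.span_eq_top_of_card_eq_finrank' (by simp)).ge

theorem eigBasis_apply (q : ℕ) (V : ℤ → ℝ) (κ : ℝ) (j : Fin q) :
    eigBasis q V κ j = eigvec q V j κ := by
  rw [eigBasis, OrthonormalBasis.coe_mk]

theorem norm_exp_neg_sub_exp_neg (s t : ℝ) :
    ‖Complex.exp (-(Complex.I * s)) - Complex.exp (-(Complex.I * t))‖
      = ‖Complex.exp (Complex.I * s) - Complex.exp (Complex.I * t)‖ := by
  rw [← RCLike.norm_conj, map_sub, ← Complex.exp_conj, ← Complex.exp_conj]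
  simp

theorem floquet_sub_floquet (q : ℕ) [NeZero q] (V : ℤ → ℝ) (κ κ' : ℝ) :
    floquet q V κ - floquet q V κ' =
      Matrix.single 0 (Fin.rev 0)
        (Complex.exp (Complex.I * (q * κ : ℝ)) - Complex.exp (Complex.I * (q * κ' : ℝ))) +
      Matrix.single (Fin.rev 0) 0
        (Complex.exp (-(Complex.I * (q * κ : ℝ))) - Complex.exp (-(Complex.I * (q * κ' : ℝ)))) := by
  have hq := Nat.pos_of_ne_zero (NeZero.ne q)
  ext l m
  have e1 : ∀ i : Fin q, ((i : ℕ) = 0) ↔ (0 : Fin q) = i := fun i => by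
    rw [eq_comm (a := (0 : Fin q)), Fin.ext_iff, Fin.val_zero]
  have e2 : ∀ i : Fin q, ((i : ℕ) + 1 = q) ↔ Fin.rev (0 : Fin q) = i := fun i => by
    rw [Fin.ext_iff, Fin.val_rev, Fin.val_zero]
    omega
  simp only [Matrix.sub_apply, Matrix.add_apply, floquet, Matrix.of_apply, Matrix.single_apply,
    e1, e2]
  simp only [and_comm (a := 0 = m)]
  split_ifs <;> ring

theorem norm_toEuclideanLin_single_le {q : ℕ} (i j : Fin q) (c : ℂ)
    (x : EuclideanSpace ℂ (Fin q)) :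
    ‖Matrix.toEuclideanLin (Matrix.single i j c) x‖ ≤ ‖c‖ * ‖x‖ := by
  have : Matrix.toEuclideanLin (Matrix.single i j c) x = EuclideanSpace.single i (c * x j) := by
    ext l
    change (Matrix.single i j c).mulVec x l = _
    rw [Matrix.single_mulVec_eq]
    simp [Pi.single_apply]
  rw [this, PiLp.norm_single, norm_mul]
  exact mul_le_mul_of_nonneg_left (PiLp.norm_apply_le x j) (norm_nonneg _)

/-- Only the two corner entries depend on `κ`, and each perturbs the quadratic form by at most the
difference of the multipliers times `‖x‖²`. The bound is symmetric in `κ` and `κ'` and so yields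
continuity. -/
theorem eigval_le_add (q : ℕ) [NeZero q] (V : ℤ → ℝ) (j : Fin q) (κ κ' : ℝ) :
    eigval q V j κ ≤ eigval q V j κ' +
      2 * ‖Complex.exp (Complex.I * (q * κ : ℝ)) - Complex.exp (Complex.I * (q * κ' : ℝ))‖ := by
  refine eigenvalue_le_add_of_form_le (floquetLin_isSymmetric q V κ)
    (floquetLin_isSymmetric q V κ') (eigBasis q V κ) (eigBasis q V κ')
    (fun i => by rw [eigBasis_apply, floquetLin_eigvec])
    (fun i => by rw [eigBasis_apply, floquetLin_eigvec]) (eigval_monotone q V κ)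
    (eigval_monotone q V κ') (fun x => ?_) j
  have e : floquetLin q V κ x = floquetLin q V κ' x +
      Matrix.toEuclideanLin (floquet q V κ - floquet q V κ') x := by
    rw [map_sub, LinearMap.sub_apply, floquetLin, floquetLin]
    abel
  rw [e, inner_add_right, Complex.add_re]
  gcongr
  refine (Complex.re_le_norm _).trans ((norm_inner_le_norm _ _).trans ?_)
  rw [floquet_sub_floquet, map_add, LinearMap.add_apply]
  have h := norm_add_le_of_le
    (norm_toEuclideanLin_single_le (0 : Fin q) (Fin.rev 0)
      (Complex.exp (Complex.I * (q * κ : ℝ)) - Complex.exp (Complex.I * (q * κ' : ℝ))) x)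
    (norm_toEuclideanLin_single_le (Fin.rev 0) (0 : Fin q)
      (Complex.exp (-(Complex.I * (q * κ : ℝ))) - Complex.exp (-(Complex.I * (q * κ' : ℝ)))) x)
  rw [norm_exp_neg_sub_exp_neg] at h
  calc _ ≤ _ := mul_le_mul_of_nonneg_left h (norm_nonneg x)
    _ = _ := by ring

theorem continuous_eigval (q : ℕ) [NeZero q] (V : ℤ → ℝ) (j : Fin q) :
    Continuous (eigval q V j) := by
  rw [continuous_iff_continuousAt]
  intro κ₀
  have hb : ∀ κ, dist (eigval q V j κ) (eigval q V j κ₀) ≤ 2 * ‖Complex.exp (Complex.I *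
      (q * κ : ℝ)) - Complex.exp (Complex.I * (q * κ₀ : ℝ))‖ := fun κ => by
    rw [Real.dist_eq, abs_le]
    have h1 := eigval_le_add q V j κ κ₀
    have h2 := eigval_le_add q V j κ₀ κ
    rw [norm_sub_rev] at h2
    constructor <;> linarith
  rw [ContinuousAt, tendsto_iff_dist_tendsto_zero]
  refine squeeze_zero (fun _ => dist_nonneg) hb ?_
  have hc : Continuous fun κ : ℝ => 2 * ‖Complex.exp (Complex.I * (q * κ : ℝ))
      - Complex.exp (Complex.I * (q * κ₀ : ℝ))‖ := by fun_prop
  have := hc.tendsto κ₀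
  simpa using this

end PeriodicSchrodinger


/-! ### Transfer matrices and the discriminant -/

open Polynomial

namespace PeriodicSchrodinger

section Transfer

variable {R : Type*} [CommRing R]

/-- The one-step transfer matrix. -/
def transfer (x : R) : Matrix (Fin 2) (Fin 2) R := !![0, 1; -1, x]

/-- The transfer matrix from the sites `m, m + 1` to the sites `m + k, m + k + 1`. -/
def transferProd (a : ℤ → R) (m : ℤ) : ℕ → Matrix (Fin 2) (Fin 2) R
  | 0 => 1
  | k + 1 => transfer (a (m + k + 1)) * transferProd a m k

theorem det_transfer (x : R) : (transfer x).det = 1 := by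
  simp [transfer, Matrix.det_fin_two]

theorem det_transferProd (a : ℤ → R) (m : ℤ) (k : ℕ) : (transferProd a m k).det = 1 := by
  induction k with
  | zero => exact Matrix.det_one
  | succ k ih => rw [transferProd, Matrix.det_mul, det_transfer, ih, one_mul]

theorem transferProd_succ' (a : ℤ → R) (m : ℤ) (k : ℕ) :
    transferProd a m (k + 1) = transferProd a (m + 1) k * transfer (a (m + 1)) := by
  induction k with
  | zero => simp [transferProd]
  | succ k ih =>
    rw [transferProd, ih, transferProd, Matrix.mul_assoc]
    congr 3
    push_cast
    ring

/-- Moving the base point by one site conjugates the monodromy matrix by a one-step transfer matrix.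
-/
theorem trace_transferProd_add_one {a : ℤ → R} {q : ℕ} (ha : Function.Periodic a (q : ℤ))
    (m : ℤ) : (transferProd a (m + 1) q).trace = (transferProd a m q).trace := by
  have h1 : transfer (a (m + 1)) * transferProd a m q
      = transferProd a (m + 1) q * transfer (a (m + 1)) := by
    rw [← transferProd_succ', transferProd, show m + (q : ℤ) + 1 = m + 1 + q by ring, ha]
  have hu : IsUnit (transfer (a (m + 1))).det := by rw [det_transfer]; exact isUnit_one
  rw [← Matrix.mul_nonsing_inv_cancel_right _ (transferProd a (m + 1) q) hu, ← h1,
    Matrix.trace_mul_comm, ← Matrix.mul_assoc, Matrix.nonsing_inv_mul _ hu, Matrix.one_mul]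

theorem trace_transferProd {a : ℤ → R} {q : ℕ} (ha : Function.Periodic a (q : ℤ)) (m : ℤ) :
    (transferProd a m q).trace = (transferProd a 0 q).trace := by
  induction m with
  | zero => rfl
  | succ i ih => rw [trace_transferProd_add_one ha, ih]
  | pred i ih => rw [← ih, ← trace_transferProd_add_one ha (-(i : ℤ) - 1), sub_add_cancel]

theorem transferProd_mulVec {a u : ℤ → R} {m : ℤ} {k : ℕ}
    (h : ∀ s, m < s → s ≤ m + k → u (s - 1) + u (s + 1) = a s * u s) :
    (transferProd a m k).mulVec ![u m, u (m + 1)] = ![u (m + k), u (m + k + 1)] := by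
  induction k with
  | zero => simp [transferProd]
  | succ k ih =>
    rw [transferProd, ← Matrix.mulVec_mulVec, ih fun s h1 h2 => h s h1 (by push_cast; omega)]
    have h1 := h (m + k + 1) (by omega) (by push_cast; omega)
    rw [add_sub_cancel_right] at h1
    ext i
    fin_cases i
    · simp [transfer, Matrix.mulVec, dotProduct, Fin.sum_univ_two, add_assoc]
    · simp only [transfer, Matrix.mulVec, dotProduct, Fin.sum_univ_two]
      simp only [Fin.mk_one, Matrix.of_apply, Matrix.cons_val', Matrix.cons_val_zero,
        Matrix.cons_val_one, Matrix.cons_val_fin_one]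
      push_cast
      rw [← add_assoc m, ← h1]
      ring

theorem mulVec_mulVec_eq_trace_smul_sub {M : Matrix (Fin 2) (Fin 2) R} (hM : M.det = 1)
    (v : Fin 2 → R) : M.mulVec (M.mulVec v) = M.trace • M.mulVec v - v := by
  rw [Matrix.det_fin_two] at hM
  ext i
  fin_cases i
  · simp [Matrix.mulVec, dotProduct, Fin.sum_univ_two, Matrix.trace]
    linear_combination (-v 0) * hM
  · simp [Matrix.mulVec, dotProduct, Fin.sum_univ_two, Matrix.trace]
    linear_combination (-v 1) * hM

/-- Cayley–Hamilton for the monodromy matrix, `M² = (tr M) M - 1`, applied to the data at `m, m +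
1`. Both components are kept: the second is needed to the left of a source, where the first would
use the equation at one site too many. -/
theorem solution_recurrence {a u : ℤ → R} {q : ℕ} (ha : Function.Periodic a (q : ℤ)) {m : ℤ}
    (h : ∀ s, m < s → s ≤ m + 2 * q → u (s - 1) + u (s + 1) = a s * u s) :
    u (m + 2 * q) = (transferProd a 0 q).trace * u (m + q) - u m ∧
    u (m + 1 + 2 * q) = (transferProd a 0 q).trace * u (m + 1 + q) - u (m + 1) := by
  have h1 := transferProd_mulVec (a := a) (u := u) (m := m) (k := q)
    fun s h1 h2 => h s h1 (by omega)
  have h2 := transferProd_mulVec (a := a) (u := u) (m := m + q) (k := q)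
    fun s h1 h2 => h s (by omega) (by omega)
  have hper : ∀ k : ℕ, transferProd a (m + q) k = transferProd a m k := fun k => by
    induction k with
    | zero => rfl
    | succ k ih =>
      rw [transferProd, transferProd, ih, show m + (q : ℤ) + k + 1 = m + k + 1 + q by ring, ha]
  rw [hper] at h2
  have h3 := mulVec_mulVec_eq_trace_smul_sub (det_transferProd a m q) ![u m, u (m + 1)]
  rw [h1, h2, trace_transferProd ha] at h3
  have e0 := congrFun h3 0
  have e1 := congrFun h3 1
  simp at e0 e1
  constructor
  · rw [← e0]; congr 1; ring
  · rw [show m + 1 + 2 * (q : ℤ) = m + q + q + 1 by ring, show m + 1 + (q : ℤ) = m + q + 1 by ring,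
      ← e1]

theorem map_transferProd {S : Type*} [CommRing S] (f : R →+* S) (a : ℤ → R) (m : ℤ) (k : ℕ) :
    (transferProd a m k).map f = transferProd (fun s => f (a s)) m k := by
  induction k with
  | zero => exact Matrix.map_one _ (map_zero f) (map_one f)
  | succ k ih =>
    rw [transferProd, transferProd, Matrix.map_mul, ih]
    congr 1
    ext i j
    fin_cases i <;> fin_cases j <;> simp [transfer]

end Transfer

/-- The discriminant (Lyapunov function) of the periodic operator: the trace of the monodromy
matrix, as a polynomial in the energy. -/
noncomputable def discr (q : ℕ) (V : ℤ → ℝ) : ℂ[X] :=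
  (transferProd (fun s => X - C (V s : ℂ)) 0 q).trace

theorem eval_discr (q : ℕ) (V : ℤ → ℝ) (z : ℂ) :
    (discr q V).eval z = (transferProd (fun s => z - (V s : ℂ)) 0 q).trace := by
  have h := map_transferProd (evalRingHom z) (fun s => X - C (V s : ℂ)) 0 q
  simp only [coe_evalRingHom, eval_sub, eval_X, eval_C] at h
  rw [← h, discr, ← coe_evalRingHom, AddMonoidHom.map_trace]

/-- Each new bottom row is `X - V` times the old bottom row minus the old top row, so the induction
has to carry all four entries. The upper left bound is `k + 1` because that entry is `1` at `k = 0`.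
-/
theorem degree_transferProd (V : ℤ → ℝ) (m : ℤ) (k : ℕ) :
    (transferProd (fun s => X - C (V s : ℂ)) m k 1 1).Monic ∧
    (transferProd (fun s => X - C (V s : ℂ)) m k 1 1).natDegree = k ∧
    (transferProd (fun s => X - C (V s : ℂ)) m k 0 1).degree < (k : WithBot ℕ) ∧
    (transferProd (fun s => X - C (V s : ℂ)) m k 1 0).degree < (k : WithBot ℕ) ∧
    (transferProd (fun s => X - C (V s : ℂ)) m k 0 0).degree < ((k + 1 : ℕ) : WithBot ℕ) := by
  induction k with
  | zero => simp [transferProd]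
  | succ k ih =>
    obtain ⟨h1, h2, h3, h4, h5⟩ := ih
    have e : ∀ j, transferProd (fun s => X - C (V s : ℂ)) m (k + 1) 0 j
        = transferProd (fun s => X - C (V s : ℂ)) m k 1 j := fun j => by
      simp [transferProd, transfer, Matrix.mul_apply, Fin.sum_univ_two]
    have e' : ∀ j, transferProd (fun s => X - C (V s : ℂ)) m (k + 1) 1 j
        = (X - C (V (m + k + 1) : ℂ)) * transferProd (fun s => X - C (V s : ℂ)) m k 1 j
          - transferProd (fun s => X - C (V s : ℂ)) m k 0 j := fun j => by
      simp [transferProd, transfer, Matrix.mul_apply, Fin.sum_univ_two]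
      ring
    have hm : ((X - C (V (m + k + 1) : ℂ)) *
        transferProd (fun s => X - C (V s : ℂ)) m k 1 1).Monic := (monic_X_sub_C _).mul h1
    have hd : ((X - C (V (m + k + 1) : ℂ)) *
        transferProd (fun s => X - C (V s : ℂ)) m k 1 1).natDegree = k + 1 := by
      rw [(monic_X_sub_C _).natDegree_mul h1, h2, natDegree_X_sub_C, add_comm]
    have hk : ((k : ℕ) : WithBot ℕ) < ((k + 1 : ℕ) : WithBot ℕ) := by exact_mod_cast Nat.lt_succ_self k
    have hlt : (transferProd (fun s => X - C (V s : ℂ)) m k 0 1).degree <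
        ((X - C (V (m + k + 1) : ℂ)) *
        transferProd (fun s => X - C (V s : ℂ)) m k 1 1).degree := by
      rw [degree_eq_natDegree hm.ne_zero, hd]
      exact h3.trans hk
    rw [e, e, e', e']
    refine ⟨hm.sub_of_left hlt, ?_, ?_, ?_, ?_⟩
    · rw [natDegree_eq_of_degree_eq (degree_sub_eq_left_of_degree_lt hlt), hd]
    · rw [degree_eq_natDegree h1.ne_zero, h2]; exact hk
    · refine (degree_sub_le _ _).trans_lt (max_lt ?_ h5)
      by_cases h0 : transferProd (fun s => X - C (V s : ℂ)) m k 1 0 = 0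
      · rw [h0, mul_zero, degree_zero]; exact WithBot.bot_lt_coe _
      · rw [degree_mul, degree_X_sub_C, degree_eq_natDegree h0]
        rw [degree_eq_natDegree h0] at h4
        norm_cast at h4 ⊢
        omega
    · refine h4.trans (hk.trans ?_)
      exact_mod_cast Nat.lt_succ_self (k + 1)

theorem monic_discr_sub_C {q : ℕ} (hq : 1 ≤ q) (V : ℤ → ℝ) (t : ℂ) :
    (discr q V - C t).Monic ∧ (discr q V - C t).natDegree = q := by
  obtain ⟨k, rfl⟩ : ∃ k, q = k + 1 := ⟨q - 1, by omega⟩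
  obtain ⟨h1, h2, -⟩ := degree_transferProd V 0 (k + 1)
  obtain ⟨-, -, -, h3, -⟩ := degree_transferProd V 0 k
  have e : transferProd (fun s => X - C (V s : ℂ)) 0 (k + 1) 0 0
        = transferProd (fun s => X - C (V s : ℂ)) 0 k 1 0 := by
    simp [transferProd, transfer, Matrix.mul_apply, Fin.sum_univ_two]
  have e2 : discr (k + 1) V - C t = transferProd (fun s => X - C (V s : ℂ)) 0 (k + 1) 1 1
      + (transferProd (fun s => X - C (V s : ℂ)) 0 k 1 0 - C t) := by
    rw [discr, Matrix.trace_fin_two, e]; ring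
  have hlt : (transferProd (fun s => X - C (V s : ℂ)) 0 k 1 0 - C t).degree <
      (transferProd (fun s => X - C (V s : ℂ)) 0 (k + 1) 1 1).degree := by
    rw [degree_eq_natDegree h1.ne_zero, h2]
    refine (degree_sub_le _ _).trans_lt (max_lt (h3.trans ?_) (degree_C_le.trans_lt ?_))
    · exact_mod_cast Nat.lt_succ_self k
    · exact_mod_cast Nat.succ_pos k
  rw [e2]
  refine ⟨h1.add_of_left hlt, ?_⟩
  rw [natDegree_add_eq_left_of_degree_lt hlt, h2]

theorem natDegree_discr {q : ℕ} (hq : 1 ≤ q) (V : ℤ → ℝ) : (discr q V).natDegree = q := by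
  simpa using (monic_discr_sub_C hq V 0).2

/-- The sequence `x(n+1) - ρ x(n)` is geometric with ratio `ρ⁻¹` of modulus at least `1`, yet tends
to `0`; hence it vanishes. The case `|ρ| = 1` is included because strict decay is deduced only
afterwards. -/
theorem eq_pow_mul_of_recurrence {x : ℕ → ℂ} {ρ : ℂ} (hρ : ρ ≠ 0) (hρ1 : ‖ρ‖ ≤ 1)
    (hx : ∀ n, x (n + 2) = (ρ + ρ⁻¹) * x (n + 1) - x n)
    (h0 : Filter.Tendsto x Filter.atTop (nhds 0)) (n : ℕ) : x n = ρ ^ n * x 0 := by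
  have hy : ∀ n, x (n + 1) - ρ * x n = (ρ⁻¹) ^ n * (x 1 - ρ * x 0) := by
    intro n
    induction n with
    | zero => simp
    | succ n ih =>
      rw [hx, pow_succ, mul_right_comm, ← ih]
      field_simp
      ring
  have hlim : Filter.Tendsto (fun n => ‖x (n + 1) - ρ * x n‖) Filter.atTop (nhds 0) := by
    have := ((h0.comp (Filter.tendsto_add_atTop_nat 1)).sub (h0.const_mul ρ)).norm
    simpa using this
  have h1 : x 1 - ρ * x 0 = 0 := by
    have h2 : 1 ≤ ‖ρ‖⁻¹ := (one_le_inv₀ (norm_pos_iff.mpr hρ)).mpr hρ1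
    refine norm_le_zero_iff.mp ?_
    refine ge_of_tendsto' hlim fun n => ?_
    rw [hy n, norm_mul, norm_pow, norm_inv]
    exact le_mul_of_one_le_left (norm_nonneg (x 1 - ρ * x 0)) (one_le_pow₀ h2)
  induction n with
  | zero => simp
  | succ n ih =>
    have := hy n
    rw [h1, mul_zero, sub_eq_zero] at this
    rw [this, ih, pow_succ']
    ring

end PeriodicSchrodinger


/-! ### Bloch solutions and the spectrum of the Floquet matrix -/

open Polynomial

namespace PeriodicSchrodinger

/-- The Floquet multiplier `e^{iqκ}`. -/
noncomputable def multiplier (q : ℕ) (κ : ℝ) : ℂ := Complex.exp (Complex.I * (q * κ : ℝ))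

theorem multiplier_ne_zero (q : ℕ) (κ : ℝ) : multiplier q κ ≠ 0 := Complex.exp_ne_zero _

theorem norm_multiplier (q : ℕ) (κ : ℝ) : ‖multiplier q κ‖ = 1 := by
  rw [multiplier, mul_comm]; exact Complex.norm_exp_ofReal_mul_I _

theorem multiplier_add_inv (q : ℕ) (κ : ℝ) :
    multiplier q κ + (multiplier q κ)⁻¹ = ((2 * Real.cos (q * κ) : ℝ) : ℂ) := by
  rw [multiplier, mul_comm]; exact exp_I_add_inv _

/-- The Bloch condition `w(m + q) = ζ⁻¹ w(m)`. -/
def IsBloch (q : ℕ) (ζ : ℂ) (w : ℤ → ℂ) : Prop := ∀ m, w (m + q) = ζ⁻¹ * w m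

variable {q : ℕ} {V : ℤ → ℝ} {ζ : ℂ} {κ : ℝ}

theorem IsBloch.apply_add_mul {w : ℤ → ℂ} (hζ : ζ ≠ 0) (hw : IsBloch q ζ w) (m n : ℤ) :
    w (m + n * q) = ζ ^ (-n) * w m := by
  induction n with
  | zero => simp
  | succ i ih =>
    rw [show m + ((i : ℤ) + 1) * q = m + i * q + q by ring, hw, ih, neg_add, zpow_add₀ hζ,
      zpow_neg_one]
    ring
  | pred i ih =>
    have := hw (m + (-(i : ℤ) - 1) * q)
    rw [show m + (-(i : ℤ) - 1) * q + q = m + -(i : ℤ) * q by ring, ih] at this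
    rw [neg_neg, zpow_natCast] at this
    rw [neg_sub, sub_neg_eq_add, zpow_add₀ hζ, zpow_natCast, zpow_one, mul_assoc, this]
    field_simp

theorem IsBloch.eq_zero_of_block {w : ℤ → ℂ} (hq : 0 < q) (hζ : ζ ≠ 0) (hw : IsBloch q ζ w)
    (h : ∀ l : Fin q, w (l : ℕ) = 0) (m : ℤ) : w m = 0 := by
  have hq' : (0 : ℤ) < q := by exact_mod_cast hq
  have h1 := hw.apply_add_mul hζ (m % q) (m / q)
  rw [mul_comm, Int.emod_add_mul_ediv] at h1
  have h2 := h ⟨(m % q).toNat, by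
    have := Int.emod_lt_of_pos m hq'
    have := Int.emod_nonneg m hq'.ne'
    omega⟩
  simp only [Int.toNat_of_nonneg (Int.emod_nonneg m hq'.ne')] at h2
  rw [h1, h2, mul_zero]

/-- The difference expression `w(m - 1) + w(m + 1) + V(m) w(m)`. -/
def diffExpr (V : ℤ → ℝ) (w : ℤ → ℂ) (m : ℤ) : ℂ := w (m - 1) + w (m + 1) + V m * w m

theorem IsBloch.diffExpr_sub {w : ℤ → ℂ} (hV : Function.Periodic V (q : ℤ))
    (hw : IsBloch q ζ w) (z : ℂ) : IsBloch q ζ fun m => diffExpr V w m - z * w m := fun m => by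
  simp only [diffExpr]
  rw [show m + (q : ℤ) - 1 = m - 1 + q by ring, show m + (q : ℤ) + 1 = m + 1 + q by ring,
    hw, hw, hw, hV]
  ring

/-- The corner `e^{iqκ}` in row `0` supplies `w(-1) = ζ w(q-1)`, which is why the Bloch condition
carries `ζ⁻¹`. Each neighbour is the sum of one hopping and one corner contribution, so overlaps for
`q = 1, 2` need no separate case. -/
theorem floquet_mulVec_bloch {w : ℤ → ℂ} (hw : IsBloch q (multiplier q κ) w) (l : Fin q) :
    (floquet q V κ).mulVec (fun m => w (m : ℕ)) l = diffExpr V w (l : ℕ) := by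
  have hq : 0 < q := l.pos
  have hl := l.isLt
  have e0 : ∑ m : Fin q, (if l = m then (V (l : ℕ) : ℂ) else 0) * w (m : ℕ)
      = V (l : ℕ) * w (l : ℕ) := by simp
  have e1 : ∑ m : Fin q, (if (l : ℕ) + 1 = m then (1 : ℂ) else 0) * w (m : ℕ) +
      ∑ m : Fin q, (if (m : ℕ) = 0 ∧ (l : ℕ) + 1 = q then
        Complex.exp (-(Complex.I * (q * κ : ℝ))) else 0) * w (m : ℕ) = w ((l : ℕ) + 1) := by
    by_cases h : (l : ℕ) + 1 = q
    · rw [Finset.sum_eq_zero, zero_add, Finset.sum_eq_single ⟨0, hq⟩]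
      · have := hw 0
        rw [multiplier, ← Complex.exp_neg, zero_add] at this
        have h' : ((l : ℕ) : ℤ) + 1 = q := by exact_mod_cast h
        simp [h, h', this]
      · intro b _ hb
        have : (b : ℕ) ≠ 0 := fun h0 => hb (Fin.ext h0)
        simp [this]
      · simp
      · intro b _
        have : ¬ ((l : ℕ) + 1 = b) := by have := b.isLt; omega
        simp [this]
    · rw [Finset.sum_eq_single ⟨(l : ℕ) + 1, by omega⟩, Finset.sum_eq_zero (fun b _ => by simp [h])]
      · simp
      · intro b _ hb
        have : ¬ ((l : ℕ) + 1 = b) := fun h0 => hb (Fin.ext h0.symm)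
        simp [this]
      · simp
  have e2 : ∑ m : Fin q, (if (m : ℕ) + 1 = l then (1 : ℂ) else 0) * w (m : ℕ) +
      ∑ m : Fin q, (if (l : ℕ) = 0 ∧ (m : ℕ) + 1 = q then
        Complex.exp (Complex.I * (q * κ : ℝ)) else 0) * w (m : ℕ) = w ((l : ℕ) - 1) := by
    by_cases h : (l : ℕ) = 0
    · rw [Finset.sum_eq_zero, zero_add, Finset.sum_eq_single ⟨q - 1, by omega⟩]
      · have := hw (-1)
        rw [show (-1 : ℤ) + q = ((q - 1 : ℕ) : ℤ) by omega] at this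
        have h' : q - 1 + 1 = q := by omega
        simp only [h, h', and_self, if_true, this]
        rw [← mul_assoc]
        have hm := mul_inv_cancel₀ (multiplier_ne_zero q κ)
        rw [multiplier] at hm ⊢
        rw [hm]
        simp
      · intro b _ hb
        have : (b : ℕ) + 1 ≠ q := fun h0 => hb (Fin.ext (by simp; omega))
        simp [this]
      · simp
      · intro b _
        have : ¬ ((b : ℕ) + 1 = l) := by omega
        simp [this]
    · rw [Finset.sum_eq_single ⟨(l : ℕ) - 1, by omega⟩, Finset.sum_eq_zero (fun b _ => by simp [h])]
      · have h' : (l : ℕ) - 1 + 1 = l := by omega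
        have h'' : (((l : ℕ) - 1 : ℕ) : ℤ) = (l : ℕ) - 1 := by omega
        simp [h', h'']
      · intro b _ hb
        have : ¬ ((b : ℕ) + 1 = l) := fun h0 => hb (Fin.ext (by simp; omega))
        simp [this]
      · simp
  rw [diffExpr, ← e0, ← e1, ← e2, Matrix.mulVec, dotProduct]
  simp only [floquet, Matrix.of_apply, add_mul, Finset.sum_add_distrib]
  ring

/-- The Bloch sequence with prescribed values on the block `0, …, q - 1`. -/
noncomputable def blochExt (q : ℕ) [NeZero q] (ζ : ℂ) (v : Fin q → ℂ) (m : ℤ) : ℂ :=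
  ζ ^ (-(m / q)) * v (Fin.ofNat q (m % q).toNat)

theorem isBloch_blochExt [NeZero q] (hζ : ζ ≠ 0) (v : Fin q → ℂ) :
    IsBloch q ζ (blochExt q ζ v) := fun m => by
  have hq : (q : ℤ) ≠ 0 := by exact_mod_cast NeZero.ne q
  rw [blochExt, blochExt, Int.add_emod_right, Int.add_ediv_of_dvd_right (dvd_refl _),
    Int.ediv_self hq, neg_add, zpow_add₀ hζ, zpow_neg_one]
  ring

theorem blochExt_block [NeZero q] (v : Fin q → ℂ) (l : Fin q) :
    blochExt q ζ v (l : ℕ) = v l := by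
  have h1 : ((l : ℕ) : ℤ) / q = 0 := Int.ediv_eq_zero_of_lt (by omega) (by exact_mod_cast l.isLt)
  have h2 : ((l : ℕ) : ℤ) % q = (l : ℕ) := Int.emod_eq_of_lt (by omega) (by exact_mod_cast l.isLt)
  rw [blochExt, h1, h2]
  simp

theorem blochExt_solution [NeZero q] (hV : Function.Periodic V (q : ℤ)) {v : Fin q → ℂ} {z : ℂ}
    (hv : (floquet q V κ).mulVec v = z • v) (s : ℤ) :
    diffExpr V (blochExt q (multiplier q κ) v) s = z * blochExt q (multiplier q κ) v s := by
  have hb := isBloch_blochExt (multiplier_ne_zero q κ) v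
  have h := (hb.diffExpr_sub hV z).eq_zero_of_block (Nat.pos_of_ne_zero (NeZero.ne q))
    (multiplier_ne_zero q κ) (fun l => ?_) s
  · exact sub_eq_zero.mp h
  · rw [← floquet_mulVec_bloch hb l]
    simp only [blochExt_block]
    rw [hv]
    simp

theorem solution_eq_zero_of_initial {a u : ℤ → ℂ}
    (h : ∀ s, u (s - 1) + u (s + 1) = a s * u s) (h0 : u 0 = 0) (h1 : u 1 = 0) (n : ℕ) :
    u n = 0 := by
  have h2 := transferProd_mulVec (a := a) (u := u) (m := 0) (k := n) fun s _ _ => h s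
  rw [zero_add, h0, h1] at h2
  have e : (![0, 0] : Fin 2 → ℂ) = 0 := by ext i; fin_cases i <;> rfl
  rw [e, Matrix.mulVec_zero] at h2
  have := congrFun h2 0
  simpa using this.symm

theorem solution_of_diffExpr {w : ℤ → ℂ} {z : ℂ} {s : ℤ} (h : diffExpr V w s = z * w s) :
    w (s - 1) + w (s + 1) = (z - V s) * w s := by
  rw [diffExpr] at h
  linear_combination h

theorem transferProd_mulVec_bloch {w : ℤ → ℂ} {z : ℂ} (hw : IsBloch q ζ w)
    (h : ∀ s, diffExpr V w s = z * w s) :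
    (transferProd (fun s => z - (V s : ℂ)) 0 q).mulVec ![w 0, w 1] = ζ⁻¹ • ![w 0, w 1] := by
  have h2 := transferProd_mulVec (a := fun s => z - (V s : ℂ)) (u := w) (m := 0) (k := q)
    fun s _ _ => solution_of_diffExpr (h s)
  rw [zero_add] at h2
  rw [h2, hw 0, show (0 : ℤ) + q + 1 = 1 + q by ring, hw 1]
  ext i
  fin_cases i <;> simp

/-- Cayley–Hamilton on the eigenvector gives `ζ⁻² - Δ(z) ζ⁻¹ + 1 = 0`. -/
theorem eval_discr_of_mulVec {z : ℂ} (hζ : ζ ≠ 0) {v : Fin 2 → ℂ} (hv : v ≠ 0)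
    (h : (transferProd (fun s => z - (V s : ℂ)) 0 q).mulVec v = ζ⁻¹ • v) :
    (discr q V).eval z = ζ + ζ⁻¹ := by
  have h1 := mulVec_mulVec_eq_trace_smul_sub
    (det_transferProd (fun s => z - (V s : ℂ)) 0 q) v
  rw [h, Matrix.mulVec_smul, h, ← eval_discr] at h1
  obtain ⟨i, hi⟩ := Function.ne_iff.mp hv
  have h2 := congrFun h1 i
  simp only [Pi.smul_apply, Pi.sub_apply, smul_eq_mul] at h2
  have h3 : (ζ⁻¹ * ζ⁻¹ - (discr q V).eval z * ζ⁻¹ + 1) * v i = 0 := by linear_combination h2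
  have h4 := (mul_eq_zero.mp h3).resolve_right hi
  field_simp at h4 ⊢
  linear_combination -h4

theorem blochExt_initial_ne_zero [NeZero q] (hV : Function.Periodic V (q : ℤ)) {v : Fin q → ℂ}
    (hv0 : v ≠ 0) {z : ℂ} (hv : (floquet q V κ).mulVec v = z • v) :
    (![blochExt q (multiplier q κ) v 0, blochExt q (multiplier q κ) v 1] : Fin 2 → ℂ) ≠ 0 := by
  intro h
  apply hv0
  have hs := fun s => solution_of_diffExpr (blochExt_solution hV hv s)
  have h0 := congrFun h 0
  have h1 := congrFun h 1
  simp only [Matrix.cons_val_zero, Matrix.cons_val_one, Pi.zero_apply,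
    Matrix.cons_val_fin_one] at h0 h1
  ext l
  rw [← blochExt_block (ζ := multiplier q κ) v l]
  exact solution_eq_zero_of_initial hs h0 h1 l

theorem eval_discr_of_mulVec_floquet [NeZero q] (hV : Function.Periodic V (q : ℤ))
    {v : Fin q → ℂ} (hv0 : v ≠ 0) {z : ℂ} (hv : (floquet q V κ).mulVec v = z • v) :
    (discr q V).eval z = ((2 * Real.cos (q * κ) : ℝ) : ℂ) := by
  rw [← multiplier_add_inv]
  exact eval_discr_of_mulVec (multiplier_ne_zero q κ) (blochExt_initial_ne_zero hV hv0 hv)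
    (transferProd_mulVec_bloch (isBloch_blochExt (multiplier_ne_zero q κ) v)
      (blochExt_solution hV hv))

theorem eigvec_ne_zero (q : ℕ) (V : ℤ → ℝ) (j : Fin q) (κ : ℝ) : ⇑(eigvec q V j κ) ≠ 0 := by
  have := (eigvec_orthonormal q V κ).ne_zero j
  intro h
  exact this (by ext i; exact congrFun h i)

theorem floquet_mulVec_eigvec' (q : ℕ) (V : ℤ → ℝ) (j : Fin q) (κ : ℝ) :
    (floquet q V κ).mulVec (eigvec q V j κ) = (eigval q V j κ : ℂ) • ⇑(eigvec q V j κ) := by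
  rw [floquet_mulVec_eigvec]
  ext i
  simp

/-- The eigenvalues of the Floquet matrix solve `Δ(λ) = 2 cos(qκ)`. -/
theorem eval_discr_eigval [NeZero q] (hV : Function.Periodic V (q : ℤ)) (j : Fin q) (κ : ℝ) :
    (discr q V).eval (eigval q V j κ : ℂ) = ((2 * Real.cos (q * κ) : ℝ) : ℂ) :=
  eval_discr_of_mulVec_floquet hV (eigvec_ne_zero q V j κ) (floquet_mulVec_eigvec' q V j κ)

/-- Suppose two orthonormal eigenvectors share an eigenvalue. If their Bloch extensions have
dependent data at sites `0, 1`, a nontrivial combination has zero data and so vanishes, which is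
impossible. Otherwise the monodromy matrix is `ζ⁻¹` times the identity, and determinant `1` forces
`ζ² = 1`. -/
theorem eigval_injective [NeZero q] (hV : Function.Periodic V (q : ℤ))
    (hκ : multiplier q κ ^ 2 ≠ 1) : Function.Injective fun j => eigval q V j κ := by
  intro i j hij
  by_contra hne
  simp only at hij
  set z : ℂ := (eigval q V i κ : ℂ) with hz
  set M := transferProd (fun s => z - (V s : ℂ)) 0 q with hM
  set ζ := multiplier q κ with hζd
  have hζ : ζ ≠ 0 := multiplier_ne_zero q κ
  have hvi := floquet_mulVec_eigvec' q V i κ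
  have hvj := floquet_mulVec_eigvec' q V j κ
  rw [← hij] at hvj
  set wi := blochExt q ζ (eigvec q V i κ) with hwi
  set wj := blochExt q ζ (eigvec q V j κ) with hwj
  have hMi := transferProd_mulVec_bloch (isBloch_blochExt hζ _) (blochExt_solution hV hvi)
  have hMj := transferProd_mulVec_bloch (isBloch_blochExt hζ _) (blochExt_solution hV hvj)
  set N : Matrix (Fin 2) (Fin 2) ℂ := !![wi 0, wj 0; wi 1, wj 1] with hN
  by_cases hdet : N.det = 0
  · obtain ⟨c, hc, hNc⟩ := Matrix.exists_mulVec_eq_zero_iff.mpr hdet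
    set v : Fin q → ℂ := c 0 • ⇑(eigvec q V i κ) + c 1 • ⇑(eigvec q V j κ) with hv
    have hve : (floquet q V κ).mulVec v = z • v := by
      rw [hv, Matrix.mulVec_add, Matrix.mulVec_smul, Matrix.mulVec_smul, hvi, hvj, smul_add,
        smul_comm z, smul_comm z]
    have hv0 : v ≠ 0 := by
      intro h0
      have ho := eigvec_orthonormal q V κ
      have h0' : c 0 • eigvec q V i κ + c 1 • eigvec q V j κ = 0 := by
        ext l; exact congrFun h0 l
      have hi := congrArg (inner ℂ (eigvec q V i κ)) h0'
      have hj := congrArg (inner ℂ (eigvec q V j κ)) h0'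
      simp only [inner_add_right, inner_smul_right, inner_self_eq_norm_sq_to_K, ho.1 i, ho.1 j,
        ho.2 hne, ho.2 (Ne.symm hne), inner_zero_right] at hi hj
      simp at hi hj
      exact hc (by ext k; fin_cases k <;> simp [hi, hj])
    refine blochExt_initial_ne_zero hV hv0 hve ?_
    have hb : ∀ m, blochExt q ζ v m = c 0 * wi m + c 1 * wj m := fun m => by
      rw [hwi, hwj]
      simp only [blochExt, hv, Pi.add_apply, Pi.smul_apply, smul_eq_mul]
      ring
    have h0 := congrFun hNc 0
    have h1 := congrFun hNc 1
    simp [hN, Matrix.mulVec, dotProduct, Fin.sum_univ_two] at h0 h1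
    ext k
    rw [← hζd, hb, hb]
    fin_cases k
    · simp; linear_combination h0
    · simp; linear_combination h1
  · have hMN : M * N = ζ⁻¹ • N := by
      have i0 := congrFun hMi 0
      have i1 := congrFun hMi 1
      have j0 := congrFun hMj 0
      have j1 := congrFun hMj 1
      simp [Matrix.mulVec, dotProduct, Fin.sum_univ_two] at i0 i1 j0 j1
      ext a b
      fin_cases a <;> fin_cases b <;>
        simp [hN, Matrix.mul_apply, Fin.sum_univ_two] <;> assumption
    have hM1 : M = ζ⁻¹ • (1 : Matrix (Fin 2) (Fin 2) ℂ) := by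
      have hu : IsUnit N.det := isUnit_iff_ne_zero.mpr hdet
      rw [← Matrix.mul_nonsing_inv_cancel_right _ M hu, hMN, Matrix.smul_mul,
        Matrix.mul_nonsing_inv _ hu]
    have hd : M.det = 1 := det_transferProd _ _ _
    rw [hM1, Matrix.det_smul, Matrix.det_one, mul_one, Fintype.card_fin, inv_pow] at hd
    exact hκ (inv_eq_one.mp hd)

theorem multiplier_sq_ne_one [NeZero q] (hκ : κ ∈ Set.Ioo 0 (Real.pi / q)) :
    multiplier q κ ^ 2 ≠ 1 := by
  have hq : (0 : ℝ) < q := by exact_mod_cast Nat.pos_of_ne_zero (NeZero.ne q)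
  have hs : 0 < Real.sin (q * κ) := by
    refine Real.sin_pos_of_pos_of_lt_pi (mul_pos hq hκ.1) ?_
    have := (lt_div_iff₀ hq).mp hκ.2
    linarith
  intro h
  have h1 : multiplier q κ - (multiplier q κ)⁻¹ = 0 := by
    have := multiplier_ne_zero q κ
    field_simp
    linear_combination h
  have h2 := congrArg Complex.im h1
  rw [Complex.inv_eq_conj (norm_multiplier q κ), Complex.sub_conj, multiplier, mul_comm Complex.I,
    Complex.exp_ofReal_mul_I_im] at h2
  norm_num at h2
  norm_cast at h2
  exact hs.ne' h2

/-- `Δ - 2 cos(qκ) = ∏_i (X - λ_i(κ))`. -/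
theorem discr_sub_eq_prod [NeZero q] (hV : Function.Periodic V (q : ℤ))
    (hκ : κ ∈ Set.Ioo 0 (Real.pi / q)) :
    discr q V - C ((2 * Real.cos (q * κ) : ℝ) : ℂ) = ∏ i : Fin q, (X - C (eigval q V i κ : ℂ)) := by
  have hq : 1 ≤ q := Nat.one_le_iff_ne_zero.mpr (NeZero.ne q)
  obtain ⟨hm, hd⟩ := monic_discr_sub_C hq V ((2 * Real.cos (q * κ) : ℝ) : ℂ)
  have hinj := eigval_injective hV (multiplier_sq_ne_one hκ)
  have hm' : (∏ i : Fin q, (X - C (eigval q V i κ : ℂ))).Monic := monic_prod_X_sub_C _ _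
  have hd' : (∏ i : Fin q, (X - C (eigval q V i κ : ℂ))).natDegree = q := by
    rw [natDegree_finsetProd_X_sub_C_eq_card]; simp
  -- Both sides are monic of degree `q` and agree at the `q` distinct eigenvalues; their difference
  -- has degree below `q`.
  refine eq_of_degree_sub_lt_of_eval_index_eq (s := Finset.univ)
    (v := fun i : Fin q => (eigval q V i κ : ℂ))
    (fun i _ j _ h => hinj (Complex.ofReal_injective h)) ?_ ?_
  · rw [Finset.card_univ, Fintype.card_fin]
    have := degree_sub_lt_left (p := discr q V - C ((2 * Real.cos (q * κ) : ℝ) : ℂ))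
      (q := ∏ i : Fin q, (X - C (eigval q V i κ : ℂ)))
      (by rw [degree_eq_natDegree hm.ne_zero, degree_eq_natDegree hm'.ne_zero, hd, hd'])
      hm.ne_zero (by rw [hm.leadingCoeff, hm'.leadingCoeff])
    rwa [degree_eq_natDegree hm.ne_zero, hd] at this
  · intro i _
    rw [eval_sub, eval_C, eval_discr_eigval hV, sub_self, eval_prod]
    exact (Finset.prod_eq_zero (Finset.mem_univ i) (by simp)).symm

end PeriodicSchrodinger


/-! ### Decay and Bloch periodization of the Green function -/

open Polynomial Filter

namespace PeriodicSchrodinger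

variable {q : ℕ} {V : ℤ → ℝ} {κ : ℝ}

section Decay

variable {u : ℤ → ℂ} {z ρ c : ℂ} {k : ℤ}

/-- `u` solves `(H - z) u = c δ_k`. -/
def SolvesWithSource (V : ℤ → ℝ) (u : ℤ → ℂ) (z c : ℂ) (k : ℤ) : Prop :=
  ∀ s, diffExpr V u s - z * u s = if s = k then c else 0

theorem SolvesWithSource.homogeneous (hu : SolvesWithSource V u z c k) {s : ℤ} (hs : s ≠ k) :
    u (s - 1) + u (s + 1) = (z - V s) * u s := by
  have := hu s
  rw [if_neg hs, sub_eq_zero] at this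
  exact solution_of_diffExpr this

theorem periodic_sub (hV : Function.Periodic V (q : ℤ)) (z : ℂ) :
    Function.Periodic (fun s => z - (V s : ℂ)) (q : ℤ) := fun s => by
  simp only [hV s]

theorem tendsto_add_nat_mul (hq : 0 < q) (m : ℤ) :
    Tendsto (fun n : ℕ => m + n * (q : ℤ)) atTop cofinite := by
  have hq' : (q : ℤ) ≠ 0 := by exact_mod_cast hq.ne'
  have : Function.Injective fun n : ℕ => m + n * (q : ℤ) := fun a b h => by
    have := mul_right_cancel₀ hq' (add_left_cancel h)
    exact_mod_cast this
  rw [← Nat.cofinite_eq_atTop]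
  exact this.tendsto_cofinite

theorem tendsto_sub_nat_mul (hq : 0 < q) (m : ℤ) :
    Tendsto (fun n : ℕ => m - n * (q : ℤ)) atTop cofinite := by
  have hq' : (q : ℤ) ≠ 0 := by exact_mod_cast hq.ne'
  have : Function.Injective fun n : ℕ => m - n * (q : ℤ) := fun a b h => by
    have := mul_right_cancel₀ hq' (sub_right_injective h)
    exact_mod_cast this
  rw [← Nat.cofinite_eq_atTop]
  exact this.tendsto_cofinite

theorem SolvesWithSource.decay_right (hq : 0 < q) (hV : Function.Periodic V (q : ℤ))
    (hu : SolvesWithSource V u z c k) (hu0 : Tendsto u cofinite (nhds 0)) (hρ : ρ ≠ 0)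
    (hρ1 : ‖ρ‖ ≤ 1) (hρz : ρ + ρ⁻¹ = (discr q V).eval z) {m : ℤ} (hm : k ≤ m) (n : ℕ) :
    u (m + n * q) = ρ ^ n * u m := by
  have h := eq_pow_mul_of_recurrence (x := fun n : ℕ => u (m + n * q)) hρ hρ1 (fun n => ?_)
    (hu0.comp (tendsto_add_nat_mul hq m)) n
  · simpa using h
  · have hnn : (0 : ℤ) ≤ n * q := by positivity
    have := (solution_recurrence (periodic_sub hV z) (u := u) (m := m + n * q)
      fun s h1 _ => hu.homogeneous (by omega)).1
    rw [← eval_discr, ← hρz] at this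
    push_cast
    rw [show m + ((n : ℤ) + 2) * q = m + n * q + 2 * q by ring, this,
      show m + ((n : ℤ) + 1) * q = m + n * q + q by ring]

theorem SolvesWithSource.decay_left (hq : 0 < q) (hV : Function.Periodic V (q : ℤ))
    (hu : SolvesWithSource V u z c k) (hu0 : Tendsto u cofinite (nhds 0)) (hρ : ρ ≠ 0)
    (hρ1 : ‖ρ‖ ≤ 1) (hρz : ρ + ρ⁻¹ = (discr q V).eval z) {m : ℤ} (hm : m ≤ k) (n : ℕ) :
    u (m - n * q) = ρ ^ n * u m := by
  have h := eq_pow_mul_of_recurrence (x := fun n : ℕ => u (m - n * q)) hρ hρ1 (fun n => ?_)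
    (hu0.comp (tendsto_sub_nat_mul hq m)) n
  · simpa using h
  · have hnn : (0 : ℤ) ≤ n * q := by positivity
    -- The base is shifted by `-1` and the second component taken: the equation is then used only up
    -- to the site `m - nq - 1`, strictly left of the source even when `m = k` and `n = 0`.
    have := (solution_recurrence (periodic_sub hV z) (u := u) (m := m - (n + 2) * q - 1)
      fun s _ h2 => hu.homogeneous (by
        have : m - ((n : ℤ) + 2) * q - 1 + 2 * q = m - n * q - 1 := by ring
        omega)).2
    rw [← eval_discr, ← hρz] at this
    push_cast
    rw [show m - ((n : ℤ) + 2) * q - 1 + 1 + 2 * q = m - n * q by ring,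
      show m - ((n : ℤ) + 2) * q - 1 + 1 + q = m - (n + 1) * q by ring,
      show m - ((n : ℤ) + 2) * q - 1 + 1 = m - (n + 2) * q by ring] at this
    linear_combination this

/-- If `|ρ| = 1`, then `|u|` is constant along each progression of step `q` going away from the
source, hence zero, contradicting the nonzero source. -/
theorem SolvesWithSource.norm_lt_one (hq : 0 < q) (hV : Function.Periodic V (q : ℤ))
    (hu : SolvesWithSource V u z c k) (hu0 : Tendsto u cofinite (nhds 0)) (hc : c ≠ 0)
    (hρ : ρ ≠ 0) (hρ1 : ‖ρ‖ ≤ 1) (hρz : ρ + ρ⁻¹ = (discr q V).eval z) : ‖ρ‖ < 1 := by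
  refine lt_of_le_of_ne hρ1 fun h => ?_
  have hr : ∀ m, u m = 0 := by
    intro m
    have hl : Tendsto (fun _ : ℕ => ‖u m‖) atTop (nhds 0) := by
      rcases le_total k m with hm | hm
      · have := (hu0.comp (tendsto_add_nat_mul hq m)).norm
        simpa [hu.decay_right hq hV hu0 hρ hρ1 hρz hm, h] using this
      · have := (hu0.comp (tendsto_sub_nat_mul hq m)).norm
        simpa [hu.decay_left hq hV hu0 hρ hρ1 hρz hm, h] using this
    exact norm_eq_zero.mp (tendsto_nhds_unique tendsto_const_nhds hl)
  have := hu k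
  rw [if_pos rfl, diffExpr, hr, hr, hr] at this
  simp at this
  exact hc this.symm

theorem SolvesWithSource.summable_norm (hq : 0 < q) (hV : Function.Periodic V (q : ℤ))
    (hu : SolvesWithSource V u z c k) (hu0 : Tendsto u cofinite (nhds 0)) (hc : c ≠ 0)
    (hρ : ρ ≠ 0) (hρ1 : ‖ρ‖ ≤ 1) (hρz : ρ + ρ⁻¹ = (discr q V).eval z) (m : ℤ) :
    Summable fun n : ℤ => ‖u (m + n * q)‖ := by
  have hlt := hu.norm_lt_one hq hV hu0 hc hρ hρ1 hρz
  have hg := summable_geometric_of_lt_one (norm_nonneg ρ) hlt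
  have hq' : (1 : ℤ) ≤ q := by exact_mod_cast hq
  refine Summable.of_nat_of_neg ?_ ?_
  · rw [← summable_nat_add_iff (k - m).toNat]
    have hk : k ≤ m + ((k - m).toNat : ℤ) * q := by nlinarith [Int.self_le_toNat (k - m)]
    refine (hg.mul_right ‖u (m + ((k - m).toNat : ℤ) * q)‖).congr fun n => ?_
    rw [← norm_pow, ← norm_mul, ← hu.decay_right hq hV hu0 hρ hρ1 hρz hk]
    congr 2
    push_cast
    ring
  · rw [← summable_nat_add_iff (m - k).toNat]
    have hk : m - ((m - k).toNat : ℤ) * q ≤ k := by nlinarith [Int.self_le_toNat (m - k)]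
    refine (hg.mul_right ‖u (m - ((m - k).toNat : ℤ) * q)‖).congr fun n => ?_
    rw [← norm_pow, ← norm_mul, ← hu.decay_left hq hV hu0 hρ hρ1 hρz hk]
    congr 2
    push_cast
    ring

end Decay

section Periodization

variable {u : ℤ → ℂ} {z ρ c ζ : ℂ} {k : ℤ}

/-- The Bloch periodization `∑_n ζⁿ u(m + nq)`. -/
noncomputable def periodize (q : ℕ) (ζ : ℂ) (u : ℤ → ℂ) (m : ℤ) : ℂ :=
  ∑' n : ℤ, ζ ^ n * u (m + n * q)

theorem isBloch_periodize (hζ : ζ ≠ 0) (u : ℤ → ℂ) : IsBloch q ζ (periodize q ζ u) := fun m => by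
  rw [periodize, periodize, ← tsum_mul_left, ← (Equiv.addRight (1 : ℤ)).tsum_eq fun n : ℤ =>
    ζ⁻¹ * (ζ ^ n * u (m + n * q))]
  refine tsum_congr fun n => ?_
  rw [Equiv.coe_addRight, zpow_add₀ hζ, zpow_one,
    show m + (q : ℤ) + n * q = m + (n + 1) * q by ring]
  field_simp

theorem summable_zpow_mul (hζ1 : ‖ζ‖ = 1) {m : ℤ} (h : Summable fun n : ℤ => ‖u (m + n * q)‖) :
    Summable fun n : ℤ => ζ ^ n * u (m + n * q) :=
  Summable.of_norm (h.congr fun n => by rw [norm_mul, norm_zpow, hζ1, one_zpow, one_mul])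

theorem diffExpr_periodize (hV : Function.Periodic V (q : ℤ)) (hζ1 : ‖ζ‖ = 1)
    (h : ∀ m, Summable fun n : ℤ => ‖u (m + n * q)‖) (m : ℤ) :
    diffExpr V (periodize q ζ u) m - z * periodize q ζ u m =
      ∑' n : ℤ, ζ ^ n * (diffExpr V u (m + n * q) - z * u (m + n * q)) := by
  have hs := fun m => (summable_zpow_mul hζ1 (h m)).hasSum
  refine (HasSum.tsum_eq ?_).symm
  convert! (((hs (m - 1)).add (hs (m + 1))).add ((hs m).mul_left (V m : ℂ))).sub
    ((hs m).mul_left z) using 1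
  funext n
  have hVn : V (m + n * q) = V m := by
    have := hV.int_mul n m
    simpa using this
  rw [diffExpr, hVn, show m - 1 + n * (q : ℤ) = m + n * q - 1 by ring,
    show m + 1 + n * (q : ℤ) = m + n * q + 1 by ring]
  ring

theorem hasSum_zpow_mul_pow_natAbs (hζ1 : ‖ζ‖ = 1) (hρ1 : ‖ρ‖ < 1) :
    HasSum (fun n : ℤ => ζ ^ n * ρ ^ n.natAbs)
      ((1 - ζ * ρ)⁻¹ + ζ⁻¹ * ρ * (1 - ζ⁻¹ * ρ)⁻¹) := by
  have h1 : ‖ζ * ρ‖ < 1 := by rwa [norm_mul, hζ1, one_mul]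
  have h2 : ‖ζ⁻¹ * ρ‖ < 1 := by rwa [norm_mul, norm_inv, hζ1, inv_one, one_mul]
  refine HasSum.of_nat_of_neg_add_one ?_ ?_
  · convert! hasSum_geometric_of_norm_lt_one h1 using 1
    funext n
    rw [zpow_natCast, Int.natAbs_natCast, mul_pow]
  · convert! (hasSum_geometric_of_norm_lt_one h2).mul_left (ζ⁻¹ * ρ) using 1
    funext n
    have e : (-((n : ℤ) + 1)).natAbs = n + 1 := by omega
    have e' : -((n : ℤ) + 1) = -((n + 1 : ℕ) : ℤ) := by push_cast; ring
    rw [e, e', zpow_neg, zpow_natCast, ← inv_pow, ← mul_pow, pow_succ']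

/-- The first factor is `∑ ζⁿ ρ^{|n|}`. The identity converts between the Green function on the line
and its Bloch sum. -/
theorem poisson_kernel_identity (hζ1 : ‖ζ‖ = 1) (hρ : ρ ≠ 0) (hρ1 : ‖ρ‖ < 1) :
    ((1 - ζ * ρ)⁻¹ + ζ⁻¹ * ρ * (1 - ζ⁻¹ * ρ)⁻¹) * (ρ + ρ⁻¹ - (ζ + ζ⁻¹)) = ρ⁻¹ - ρ := by
  have hζ : ζ ≠ 0 := norm_ne_zero_iff.mp (by rw [hζ1]; exact one_ne_zero)
  have h1 : 1 - ζ * ρ ≠ 0 := fun h => by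
    have : ‖ζ * ρ‖ = 1 := by rw [← sub_eq_zero.mp h, norm_one]
    rw [norm_mul, hζ1, one_mul] at this
    exact hρ1.ne this
  have h2 : ζ - ρ ≠ 0 := fun h => by
    rw [← sub_eq_zero.mp h, hζ1] at hρ1
    exact hρ1.ne rfl
  have e : 1 - ζ⁻¹ * ρ = (ζ - ρ) / ζ := by field_simp
  rw [e]
  field_simp
  ring

/-- The periodized solution at the source. -/
theorem SolvesWithSource.periodize_source (hq : 0 < q) (hV : Function.Periodic V (q : ℤ))
    (hu : SolvesWithSource V u z c k) (hu0 : Tendsto u cofinite (nhds 0)) (hc : c ≠ 0)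
    (hρ : ρ ≠ 0) (hρ1 : ‖ρ‖ ≤ 1) (hρz : ρ + ρ⁻¹ = (discr q V).eval z) (hζ1 : ‖ζ‖ = 1) :
    periodize q ζ u k * ((discr q V).eval z - (ζ + ζ⁻¹)) = u k * (ρ⁻¹ - ρ) := by
  have hlt := hu.norm_lt_one hq hV hu0 hc hρ hρ1 hρz
  -- Both half-lines decay with the same multiplier from the source: `u(k + nq) = ρ^{|n|} u(k)`.
  have h : HasSum (fun n : ℤ => ζ ^ n * u (k + n * q))
      (((1 - ζ * ρ)⁻¹ + ζ⁻¹ * ρ * (1 - ζ⁻¹ * ρ)⁻¹) * u k) := by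
    convert! (hasSum_zpow_mul_pow_natAbs hζ1 hlt).mul_right (u k) using 1
    funext n
    rw [mul_assoc]
    congr 1
    rcases Int.natAbs_eq n with hn | hn
    · conv_lhs => rw [hn]
      exact hu.decay_right hq hV hu0 hρ hρ1 hρz le_rfl _
    · conv_lhs => rw [hn, neg_mul, ← sub_eq_add_neg]
      exact hu.decay_left hq hV hu0 hρ hρ1 hρz le_rfl _
  rw [periodize, h.tsum_eq, ← hρz, mul_right_comm, poisson_kernel_identity hζ1 hρ hlt, mul_comm]

/-- The block of the periodized solution solves a Floquet equation with a point source. -/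
theorem SolvesWithSource.floquet_periodize [NeZero q] (hV : Function.Periodic V (q : ℤ))
    (hu : SolvesWithSource V u z c k)
    (hs : ∀ m, Summable fun n : ℤ => ‖u (m + n * q)‖) {i : Fin q} {n₀ : ℤ}
    (hi : (i : ℕ) + n₀ * q = k) :
    floquetLin q V κ (WithLp.toLp 2 fun l => periodize q (multiplier q κ) u (l : ℕ))
      - z • (WithLp.toLp 2 fun l : Fin q => periodize q (multiplier q κ) u (l : ℕ)) =
      EuclideanSpace.single i (multiplier q κ ^ n₀ * c) := by
  ext l
  have hq : (0 : ℤ) < q := by exact_mod_cast Nat.pos_of_ne_zero (NeZero.ne q)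
  rw [PiLp.sub_apply, floquetLin_apply]
  change (floquet q V κ).mulVec (fun l : Fin q => periodize q (multiplier q κ) u (l : ℕ)) l
    - z * periodize q (multiplier q κ) u (l : ℕ) = _
  rw [floquet_mulVec_bloch (isBloch_periodize (multiplier_ne_zero q κ) u),
    diffExpr_periodize hV (norm_multiplier q κ) hs]
  -- Among all translates of the sites `0, …, q - 1`, only that of site `i` by `n₀` periods meets
  -- the source, so one term of the periodized source survives.
  have he : ∀ n : ℤ, ((l : ℕ) : ℤ) + n * q = k ↔ l = i ∧ n = n₀ := fun n => by
    constructor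
    · intro h
      have hl : ((l : ℕ) : ℤ) = k % q := by
        rw [← h, Int.add_mul_emod_self_right, Int.emod_eq_of_lt (by omega)
          (by exact_mod_cast l.isLt)]
      have hi' : ((i : ℕ) : ℤ) = k % q := by
        rw [← hi, Int.add_mul_emod_self_right, Int.emod_eq_of_lt (by omega)
          (by exact_mod_cast i.isLt)]
      have hli : l = i := Fin.ext (by exact_mod_cast hl.trans hi'.symm)
      refine ⟨hli, ?_⟩
      rw [hli, ← hi] at h
      exact mul_right_cancel₀ hq.ne' (add_left_cancel h)
    · rintro ⟨rfl, rfl⟩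
      exact hi
  have e : ∀ n : ℤ, multiplier q κ ^ n * (diffExpr V u ((l : ℕ) + n * q) - z * u ((l : ℕ) + n * q))
      = if n = n₀ then (if l = i then multiplier q κ ^ n * c else 0) else 0 := fun n => by
    rw [hu]
    simp only [he n]
    by_cases h1 : l = i <;> by_cases h2 : n = n₀ <;> simp [h1, h2]
  rw [tsum_congr e, tsum_ite_eq]
  simp

end Periodization

/-- A point-source response of a symmetric operator, evaluated right above an eigenvalue. -/
theorem norm_inner_sq_le_of_source {F : Type*} [NormedAddCommGroup F] [InnerProductSpace ℂ F]
    {A : F →ₗ[ℂ] F} (hA : A.IsSymmetric) {ψ e U : F} (hψ : ‖ψ‖ = 1) {E ε : ℝ}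
    (hε : 0 < ε) (hAψ : A ψ = (E : ℂ) • ψ) {c : ℂ}
    (hU : A U - ((E : ℂ) + Complex.I * ε) • U = c • e) :
    ‖c‖ * ‖inner ℂ ψ e‖ ^ 2 ≤ ε * ‖inner ℂ e U‖ := by
  -- Pairing the equation with `ψ` gives `h1`; the imaginary part of the pairing with `U` gives
  -- `h2`. With `|⟨ψ,U⟩| ≤ ‖U‖` these combine to the claim after cancelling `‖c‖`.
  have h1 : ε * ‖inner ℂ ψ U‖ = ‖c‖ * ‖inner ℂ ψ e‖ := by
    have := congrArg (inner ℂ ψ) hU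
    rw [inner_sub_right, inner_smul_right, inner_smul_right, ← hA ψ U, hAψ, inner_smul_left,
      Complex.conj_ofReal] at this
    rw [← norm_mul, ← this]
    have e : (E : ℂ) * inner ℂ ψ U - ((E : ℂ) + Complex.I * ε) * inner ℂ ψ U
        = -(Complex.I * ε * inner ℂ ψ U) := by ring
    rw [e, norm_neg, norm_mul, norm_mul, Complex.norm_I, one_mul, Complex.norm_real,
      Real.norm_of_nonneg hε.le]
  have h2 : ε * ‖U‖ ^ 2 ≤ ‖c‖ * ‖inner ℂ e U‖ := by
    have := congrArg (inner ℂ U) hU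
    rw [inner_sub_right, inner_smul_right, inner_smul_right, inner_self_eq_norm_sq_to_K] at this
    have him := congrArg Complex.im this
    have hre : (inner ℂ U (A U)).im = 0 := by
      have h := inner_conj_symm (𝕜 := ℂ) U (A U)
      rw [hA U U] at h
      exact Complex.conj_eq_iff_im.mp h
    have e2 : (((E : ℂ) + Complex.I * ε) * ((‖U‖ : ℝ) : ℂ) ^ 2).im = ε * ‖U‖ ^ 2 := by
      rw [← Complex.ofReal_pow, Complex.im_mul_ofReal]
      simp
    rw [Complex.sub_im, hre, zero_sub] at him
    have e3 : ε * ‖U‖ ^ 2 = -(c * inner ℂ U e).im := by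
      rw [← him, ← e2]; simp
    rw [e3, ← norm_inner_symm (𝕜 := ℂ) U e, ← norm_mul]
    exact (neg_le_abs _).trans (Complex.abs_im_le_norm _)
  have h3 : ‖inner ℂ ψ U‖ ≤ ‖U‖ := by
    have := norm_inner_le_norm (𝕜 := ℂ) ψ U
    rwa [hψ, one_mul] at this
  rcases (norm_nonneg c).eq_or_lt with hc | hc
  · rw [← hc, zero_mul]; positivity
  · have h4 : ‖c‖ * (‖c‖ * ‖inner ℂ ψ e‖ ^ 2) ≤ ‖c‖ * (ε * ‖inner ℂ e U‖) := by
      calc ‖c‖ * (‖c‖ * ‖inner ℂ ψ e‖ ^ 2) = (ε * ‖inner ℂ ψ U‖) ^ 2 := by rw [h1]; ring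
        _ ≤ (ε * ‖U‖) ^ 2 := by gcongr
        _ = ε * (ε * ‖U‖ ^ 2) := by ring
        _ ≤ ε * (‖c‖ * ‖inner ℂ e U‖) := by gcongr
        _ = _ := by ring
    exact le_of_mul_le_mul_left h4 hc

/-- Real-rootedness of `Δ - 2 cos(qκ)` bounds it from below above its zeros. -/
theorem mul_norm_derivative_discr_le [NeZero q] (hV : Function.Periodic V (q : ℤ))
    (hκ : κ ∈ Set.Ioo 0 (Real.pi / q)) (j : Fin q) {ε : ℝ} (hε : 0 ≤ ε) :
    ε * ‖(derivative (discr q V)).eval (eigval q V j κ : ℂ)‖ ≤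
      ‖(discr q V).eval ((eigval q V j κ : ℂ) + Complex.I * ε)
        - ((2 * Real.cos (q * κ) : ℝ) : ℂ)‖ := by
  have h := discr_sub_eq_prod hV hκ
  rw [← Finset.mul_prod_erase _ _ (Finset.mem_univ j)] at h
  set r := ∏ i ∈ Finset.univ.erase j, (X - C (eigval q V i κ : ℂ)) with hr
  have hd := congrArg (fun p => (derivative p).eval (eigval q V j κ : ℂ)) h
  simp [derivative_mul] at hd
  have he := congrArg (fun p => p.eval ((eigval q V j κ : ℂ) + Complex.I * ε)) h
  simp only [eval_sub, eval_mul, eval_X, eval_C, add_sub_cancel_left] at he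
  rw [hd, he, norm_mul, norm_mul, Complex.norm_I, one_mul, Complex.norm_real,
    Real.norm_of_nonneg hε]
  refine mul_le_mul_of_nonneg_left ?_ hε
  rw [hr, eval_prod, eval_prod, norm_prod, norm_prod]
  refine Finset.prod_le_prod (fun _ _ => norm_nonneg _) fun i _ => ?_
  rw [eval_sub, eval_sub, eval_X, eval_X, eval_C, ← Complex.ofReal_sub, Complex.norm_real]
  -- Since all roots are real, moving up from `λ_j` can only increase the distance to each other
  -- root `λ_i`.
  refine le_trans (le_of_eq ?_) (Complex.abs_re_le_norm _)
  simp

/-- The lower bound for the diagonal Green function right above the band energy `λ_j(κ)`. -/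
theorem SolvesWithSource.green_lower_bound [NeZero q] (hV : Function.Periodic V (q : ℤ))
    {u : ℤ → ℂ} {ρ c : ℂ} {k : ℤ} {j : Fin q} {ε : ℝ} (hε : 0 < ε)
    (hκ : κ ∈ Set.Ioo 0 (Real.pi / q))
    (hu : SolvesWithSource V u ((eigval q V j κ : ℂ) + Complex.I * ε) c k)
    (hu0 : Tendsto u cofinite (nhds 0)) (hc : ‖c‖ = 1) (hρ : ρ ≠ 0) (hρ1 : ‖ρ‖ ≤ 1)
    (hρz : ρ + ρ⁻¹ = (discr q V).eval ((eigval q V j κ : ℂ) + Complex.I * ε))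
    {i : Fin q} {n₀ : ℤ} (hi : (i : ℕ) + n₀ * q = k) :
    ‖inner ℂ (eigvec q V j κ) (EuclideanSpace.single i (1 : ℂ))‖ ^ 2 *
      ‖(derivative (discr q V)).eval (eigval q V j κ : ℂ)‖ ≤ ‖u k‖ * ‖ρ⁻¹ - ρ‖ := by
  have hq : 0 < q := Nat.pos_of_ne_zero (NeZero.ne q)
  have hc0 : c ≠ 0 := norm_ne_zero_iff.mp (by rw [hc]; exact one_ne_zero)
  have hs := hu.summable_norm hq hV hu0 hc0 hρ hρ1 hρz
  have hF := hu.floquet_periodize (κ := κ) hV hs hi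
  set ζ := multiplier q κ with hζ
  set U : EuclideanSpace ℂ (Fin q) := WithLp.toLp 2 fun l => periodize q ζ u (l : ℕ) with hU
  have hF' : floquetLin q V κ U - ((eigval q V j κ : ℂ) + Complex.I * ε) • U
      = (ζ ^ n₀ * c) • EuclideanSpace.single i (1 : ℂ) := by
    rw [hF]
    ext l
    simp
  have h1 := norm_inner_sq_le_of_source (floquetLin_isSymmetric q V κ)
    ((eigvec_orthonormal q V κ).1 j) hε (floquetLin_eigvec q V j κ) hF'
  rw [norm_mul, norm_zpow, norm_multiplier, one_zpow, hc, one_mul, one_mul,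
    EuclideanSpace.inner_single_left, map_one, one_mul] at h1
  have h2 : ‖periodize q ζ u k‖ = ‖U i‖ := by
    rw [← hi, (isBloch_periodize (multiplier_ne_zero q κ) u).apply_add_mul
      (multiplier_ne_zero q κ), norm_mul, norm_zpow, norm_multiplier, one_zpow, one_mul]
  have h3 := hu.periodize_source hq hV hu0 hc0 hρ hρ1 hρz (norm_multiplier q κ)
  rw [multiplier_add_inv] at h3
  rw [← norm_mul, ← h3, norm_mul, h2]
  have h4 := mul_norm_derivative_discr_le hV hκ j hε.le
  refine le_of_mul_le_mul_left ?_ hε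
  -- The resolvent entry is of order `1/ε` and `Δ - 2 cos qκ` of order `ε`; in their product `ε`
  -- cancels.
  calc _ = ‖inner ℂ (eigvec q V j κ) (EuclideanSpace.single i (1 : ℂ))‖ ^ 2 *
        (ε * ‖(derivative (discr q V)).eval (eigval q V j κ : ℂ)‖) := by ring
    _ ≤ (ε * ‖U i‖) * _ := mul_le_mul h1 h4 (by positivity) (by positivity)
    _ = _ := by ring

end PeriodicSchrodinger


/-! ### The propagator, its Laplace transform and the energy integral -/

open MeasureTheory Filter

namespace PeriodicSchrodinger

theorem delta_inner (n : ℤ) (ψ : L2Z) : inner ℂ (delta n) ψ = ψ n := by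
  rw [delta, lp.inner_single_left]
  simp

theorem norm_delta (n : ℤ) : ‖delta n‖ = 1 := by
  rw [delta, lp.norm_single (by norm_num), norm_one]

theorem delta_apply (k s : ℤ) : delta k s = if s = k then 1 else 0 := by
  rw [delta, lp.single_apply]
  simp [Pi.single_apply]

theorem tendsto_cofinite_zero (ψ : L2Z) : Tendsto (fun n => ψ n) cofinite (nhds 0) := by
  have h2 : 0 < (2 : ENNReal).toReal := by norm_num
  have h := ((lp.memℓp ψ).summable h2).tendsto_cofinite_zero
  rw [tendsto_zero_iff_norm_tendsto_zero]
  have h3 := h.sqrt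
  simp only [ENNReal.toReal_ofNat, Real.sqrt_zero] at h3
  refine h3.congr fun n => ?_
  rw [Real.rpow_two, Real.sqrt_sq (norm_nonneg _)]

theorem shift_apply (a : ℤ) (ψ : L2Z) (n : ℤ) : shift a ψ n = ψ (n + a) := rfl

theorem potentialOp_apply (V : ℤ → ℝ) (hV : ∃ C, ∀ n, |V n| ≤ C) (ψ : L2Z) (n : ℤ) :
    potentialOp V hV ψ n = (V n : ℂ) * ψ n := rfl

theorem inner_shift_left (a : ℤ) (ψ φ : L2Z) :
    inner ℂ (shift a ψ) φ = inner ℂ ψ (shift (-a) φ) := by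
  rw [lp.inner_eq_tsum, lp.inner_eq_tsum,
    ← (Equiv.addRight a).tsum_eq fun n => inner ℂ (ψ n) (shift (-a) φ n)]
  refine tsum_congr fun n => ?_
  simp only [shift_apply, Equiv.coe_addRight, add_neg_cancel_right]

theorem inner_potentialOp_left (V : ℤ → ℝ) (hV : ∃ C, ∀ n, |V n| ≤ C) (ψ φ : L2Z) :
    inner ℂ (potentialOp V hV ψ) φ = inner ℂ ψ (potentialOp V hV φ) := by
  rw [lp.inner_eq_tsum, lp.inner_eq_tsum]
  refine tsum_congr fun n => ?_
  rw [potentialOp_apply, potentialOp_apply]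
  simp
  ring

theorem schrodinger_isSelfAdjoint (V : ℤ → ℝ) (hV : ∃ C, ∀ n, |V n| ≤ C) :
    IsSelfAdjoint (schrodinger V hV) := by
  rw [ContinuousLinearMap.isSelfAdjoint_iff_isSymmetric]
  intro ψ φ
  change inner ℂ (schrodinger V hV ψ) φ = inner ℂ ψ (schrodinger V hV φ)
  simp only [schrodinger, add_apply, inner_add_left, inner_add_right,
    inner_shift_left, inner_potentialOp_left, neg_neg]
  ring

section Propagator

variable {H : L2Z →L[ℂ] L2Z}

theorem propagator_mem_unitary (hH : IsSelfAdjoint H) (t : ℝ) :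
    propagator H t ∈ unitary (L2Z →L[ℂ] L2Z) := by
  let : NormedAlgebra ℚ (L2Z →L[ℂ] L2Z) := .restrictScalars ℚ ℂ _
  refine NormedSpace.exp_mem_unitary_of_mem_skewAdjoint ?_
  rw [skewAdjoint.mem_iff, star_smul, hH.star_eq, ← neg_smul]
  congr 1
  simp

theorem norm_propagator_apply (hH : IsSelfAdjoint H) (t : ℝ) (ψ : L2Z) :
    ‖propagator H t ψ‖ = ‖ψ‖ :=
  Unitary.norm_map (⟨_, propagator_mem_unitary hH t⟩ : unitary (L2Z →L[ℂ] L2Z)) ψ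

theorem hasDerivAt_propagator_apply (ψ : L2Z) (t : ℝ) :
    HasDerivAt (fun t => propagator H t ψ) ((-Complex.I) • H (propagator H t ψ)) t := by
  have h := (hasDerivAt_exp_smul_const' ((-Complex.I) • H) (t : ℂ)).scomp t
    Complex.ofRealCLM.hasDerivAt
  have h2 := ((ContinuousLinearMap.apply ℂ L2Z ψ).restrictScalars ℝ).hasFDerivAt.comp_hasDerivAt t h
  convert! h2 using 1
  · funext s
    simp [propagator, smul_smul, mul_comm]
  · simp [propagator, smul_smul, mul_comm]

theorem continuous_propagator_apply (ψ : L2Z) : Continuous fun t => propagator H t ψ :=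
  continuous_iff_continuousAt.mpr fun t => (hasDerivAt_propagator_apply ψ t).continuousAt

theorem continuous_inner_propagator (ψ φ : L2Z) :
    Continuous fun t => inner ℂ ψ (propagator H t φ) :=
  continuous_const.inner (continuous_propagator_apply φ)

theorem norm_inner_delta_propagator_le (hH : IsSelfAdjoint H) (m k : ℤ) (t : ℝ) :
    ‖inner ℂ (delta m) (propagator H t (delta k))‖ ≤ 1 := by
  refine (norm_inner_le_norm _ _).trans ?_
  rw [norm_propagator_apply hH, norm_delta, norm_delta, one_mul]

theorem norm_cexp_smul_propagator (hH : IsSelfAdjoint H) (z : ℂ) (k : ℤ) (t : ℝ) :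
    ‖Complex.exp (Complex.I * z * t) • propagator H t (delta k)‖ = Real.exp (-z.im * t) := by
  rw [norm_smul, norm_cexp_I_mul, norm_propagator_apply hH, norm_delta, mul_one]

theorem integrableOn_cexp_smul_propagator (hH : IsSelfAdjoint H) {z : ℂ} (hz : 0 < z.im) (k : ℤ) :
    IntegrableOn (fun t : ℝ => Complex.exp (Complex.I * z * t) • propagator H t (delta k))
      (Set.Ioi 0) := by
  have hc : Continuous fun t : ℝ =>
      Complex.exp (Complex.I * z * t) • propagator H t (delta k) :=
    (by fun_prop : Continuous fun t : ℝ => Complex.exp (Complex.I * z * t)).smul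
      (continuous_propagator_apply _)
  exact Integrable.mono' (integrableOn_exp_neg_mul hz) hc.aestronglyMeasurable
    (Eventually.of_forall fun t => (norm_cexp_smul_propagator hH z k t).le)

/-- The Laplace transform of the time evolution of `δ_k`, an `ℓ²` vector. -/
noncomputable def laplaceVec (H : L2Z →L[ℂ] L2Z) (k : ℤ) (z : ℂ) : L2Z :=
  ∫ t in Set.Ioi (0 : ℝ), Complex.exp (Complex.I * z * t) • propagator H t (delta k)

theorem laplaceVec_apply (hH : IsSelfAdjoint H) {z : ℂ} (hz : 0 < z.im) (k m : ℤ) :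
    laplaceVec H k z m = laplace (fun t => inner ℂ (delta m) (propagator H t (delta k))) z := by
  rw [← delta_inner, laplaceVec, ← integral_inner (integrableOn_cexp_smul_propagator hH hz k),
    laplace]
  simp only [inner_smul_right]

/-- The Laplace transform of the time evolution is `-i` times the resolvent applied to `δ_k`. -/
theorem map_laplaceVec_sub (hH : IsSelfAdjoint H) {z : ℂ} (hz : 0 < z.im) (k : ℤ) :
    H (laplaceVec H k z) - z • laplaceVec H k z = (-Complex.I) • delta k := by
  set F : ℝ → L2Z := fun t => Complex.exp (Complex.I * z * t) • propagator H t (delta k) with hF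
  have hint := integrableOn_cexp_smul_propagator hH hz k
  have hd : ∀ t : ℝ, HasDerivAt F ((-Complex.I) • (H (F t) - z • F t)) t := by
    intro t
    have h1 : HasDerivAt (fun t : ℝ => Complex.exp (Complex.I * z * t))
        (Complex.exp (Complex.I * z * t) * (Complex.I * z)) t := by
      have := ((hasDerivAt_id (t : ℂ)).const_mul (Complex.I * z)).cexp.comp_ofReal
      simpa using this
    convert! h1.smul (hasDerivAt_propagator_apply (H := H) (delta k) t) using 1
    simp only [hF, map_smul, smul_sub, smul_smul]
    rw [sub_eq_add_neg, ← neg_smul]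
    congr 2
    · ring
    · ring
  have hi' : IntegrableOn (fun t => (-Complex.I) • (H (F t) - z • F t)) (Set.Ioi 0) :=
    ((H.integrable_comp hint).sub (hint.smul z)).smul (-Complex.I)
  have hlim : Tendsto F atTop (nhds 0) := by
    rw [tendsto_zero_iff_norm_tendsto_zero]
    simp only [hF, norm_cexp_smul_propagator hH]
    refine Real.tendsto_exp_atBot.comp ?_
    exact tendsto_id.const_mul_atTop_of_neg (by linarith)
  have h := integral_Ioi_of_hasDerivAt_of_tendsto' (a := 0) (fun t _ => hd t) hi' hlim
  have h0 : F 0 = delta k := by simp [hF, propagator]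
  have hval : ∫ t in Set.Ioi (0 : ℝ), (-Complex.I) • (H (F t) - z • F t)
      = (-Complex.I) • (H (laplaceVec H k z) - z • laplaceVec H k z) := by
    have h1 : Integrable (fun t => H (F t)) (volume.restrict (Set.Ioi 0)) :=
      H.integrable_comp hint
    have h2 : Integrable (fun t => z • F t) (volume.restrict (Set.Ioi 0)) := hint.smul z
    rw [integral_smul, integral_sub h1 h2, integral_smul,
      ContinuousLinearMap.integral_comp_comm H hint]
    rfl
  rw [hval, h0, zero_sub] at h
  have h2 := congrArg (fun x => Complex.I • x) h
  simp only [smul_smul, mul_neg, Complex.I_mul_I, neg_neg, one_smul, smul_neg] at h2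
  rw [h2, neg_smul]

end Propagator

/-- This feeds the resolvent identity into the decay theory: the source has strength `-i`, of
modulus one, at site `k`. -/
theorem laplaceVec_solves {q : ℕ} [NeZero q] {V : ℤ → ℝ} (hV : Function.Periodic V (q : ℤ))
    {z : ℂ} (hz : 0 < z.im) (k : ℤ) :
    SolvesWithSource V (fun m => laplaceVec (periodicOp q V hV) k z m) z (-Complex.I) k := by
  intro s
  have h := map_laplaceVec_sub (H := periodicOp q V hV) (schrodinger_isSelfAdjoint _ _) hz k
  have h2 := congrArg (fun ψ : L2Z => ψ s) h
  change periodicOp q V hV (laplaceVec (periodicOp q V hV) k z) s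
    - z * laplaceVec (periodicOp q V hV) k z s = -Complex.I * delta k s at h2
  rw [periodicOp, schrodinger_apply, delta_apply] at h2
  rw [diffExpr]
  refine h2.trans ?_
  split_ifs <;> simp

/-- The Abel-averaged probability as an energy integral of Laplace transforms. -/
theorem abelProb_eq {H : L2Z →L[ℂ] L2Z} (hH : IsSelfAdjoint H) {T : ℝ} (hT : 0 < T) (n : ℤ) :
    abelProb H T n = (Real.pi * T)⁻¹ * ∫ E : ℝ,
      (‖laplaceVec H 0 (E + Complex.I * (T⁻¹ : ℝ)) n‖ ^ 2
        + ‖laplaceVec H 1 (E + Complex.I * (T⁻¹ : ℝ)) (n + 1)‖ ^ 2) := by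
  have hpi := Real.pi_pos
  have him : ∀ E : ℝ, 0 < ((E : ℂ) + Complex.I * (T⁻¹ : ℝ)).im := fun E => by
    simp; exact hT
  have hA := norm_inner_delta_propagator_le hH
  have hI : ∀ m k : ℤ, IntegrableOn (fun t : ℝ =>
      ‖inner ℂ (delta m) (propagator H t (delta k))‖ ^ 2 * Real.exp (-2 * t / T)) (Set.Ioi 0) := by
    intro m k
    refine Integrable.mono' (integrableOn_exp_neg_mul (show 0 < 2 / T by positivity)) ?_
      (Eventually.of_forall fun t => ?_)
    · exact ((((continuous_inner_propagator _ _).norm.pow 2).mul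
        (by fun_prop)).aestronglyMeasurable)
    · rw [Real.norm_of_nonneg (by positivity), show -2 * t / T = -(2 / T) * t by ring]
      exact mul_le_of_le_one_left (Real.exp_pos _).le
        (pow_le_one₀ (norm_nonneg _) (hA m k t))
  simp only [laplaceVec_apply hH (him _)]
  rw [integral_add
    (integrable_norm_sq_laplace (continuous_inner_propagator _ _) (hA n 0) hT)
    (integrable_norm_sq_laplace (continuous_inner_propagator _ _) (hA (n + 1) 1) hT),
    integral_norm_sq_laplace (continuous_inner_propagator _ _) (hA n 0) hT,
    integral_norm_sq_laplace (continuous_inner_propagator _ _) (hA (n + 1) 1) hT, abelProb]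
  simp only [add_mul]
  rw [integral_add (hI n 0) (hI (n + 1) 1)]
  field_simp

end PeriodicSchrodinger


/-! ### Lower bound for the energy density on a band -/

open Polynomial MeasureTheory Filter

namespace PeriodicSchrodinger

theorem norm_exp_sub_inv (θ : ℝ) (hθ : 0 ≤ Real.sin θ) :
    ‖Complex.exp (θ * Complex.I) - (Complex.exp (θ * Complex.I))⁻¹‖ = 2 * Real.sin θ := by
  rw [Complex.inv_eq_conj (Complex.norm_exp_ofReal_mul_I θ), Complex.sub_conj,
    Complex.exp_ofReal_mul_I_im, norm_mul, Complex.norm_I, mul_one, Complex.norm_real,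
    Real.norm_of_nonneg (by positivity)]

/-- The decaying multiplier is close to one of `e^{±iθ}` if `ρ + ρ⁻¹` is close to `2 cos θ`. -/
theorem exists_near_multiplier {ρ : ℂ} {θ τ : ℝ} (hρ : ρ ≠ 0) (hρ1 : ‖ρ‖ ≤ 1)
    (hθ : 0 < Real.sin θ) (hτ : ‖ρ + ρ⁻¹ - ((2 * Real.cos θ : ℝ) : ℂ)‖ ≤ τ) :
    ∃ ω : ℂ, ‖ω‖ = 1 ∧ ‖ω⁻¹ - ω‖ = 2 * Real.sin θ ∧ ‖ρ - ω‖ ≤ τ / Real.sin θ := by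
  set ω := Complex.exp (θ * Complex.I) with hω
  have hω0 : ω ≠ 0 := Complex.exp_ne_zero _
  have hω1 : ‖ω‖ = 1 := Complex.norm_exp_ofReal_mul_I θ
  have hd : ‖ω - ω⁻¹‖ = 2 * Real.sin θ := norm_exp_sub_inv θ hθ.le
  have h1 := norm_sub_mul_norm_sub_inv_le hρ hρ1 hω0
  rw [hω, exp_I_add_inv, ← hω] at h1
  -- Since `ω` and `ω⁻¹` are `2 sin θ` apart, `ρ` is at distance at least `sin θ` from one of them;
  -- the product bound `h1` then puts it close to the other.
  have h2 : 2 * Real.sin θ ≤ ‖ρ - ω⁻¹‖ + ‖ρ - ω‖ := by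
    rw [← hd]
    have := norm_sub_le (ρ - ω⁻¹) (ρ - ω)
    rwa [show ρ - ω⁻¹ - (ρ - ω) = ω - ω⁻¹ by ring] at this
  rcases le_total (Real.sin θ) ‖ρ - ω⁻¹‖ with h | h
  · refine ⟨ω, hω1, by rw [norm_sub_rev, hd], ?_⟩
    rw [le_div_iff₀ hθ]
    exact (mul_le_mul_of_nonneg_left h (norm_nonneg _)).trans (h1.trans hτ)
  · refine ⟨ω⁻¹, by rw [norm_inv, hω1, inv_one], by rw [inv_inv, hd], ?_⟩
    rw [le_div_iff₀ hθ, mul_comm]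
    have h' : Real.sin θ ≤ ‖ρ - ω‖ := by linarith
    exact (mul_le_mul_of_nonneg_right h' (norm_nonneg _)).trans (h1.trans hτ)

/-- With `δ = τ / sin θ`, the multiplier is within `δ` of a unimodular `ω`. The constant `5` is `2δ
+ 2 sin θ + δ` with `δ ≤ sin θ`, and the power bound is Bernoulli's inequality with `Nδ ≤ 1/2`. -/
theorem multiplier_bounds {ρ : ℂ} {θ τ : ℝ} {N : ℕ} (hN : 1 ≤ N) (hρ : ρ ≠ 0) (hρ1 : ‖ρ‖ ≤ 1)
    (hθ : 0 < Real.sin θ) (hτ : ‖ρ + ρ⁻¹ - ((2 * Real.cos θ : ℝ) : ℂ)‖ ≤ τ)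
    (hτ1 : τ ≤ Real.sin θ ^ 2) (hτ2 : N * (τ / Real.sin θ) ≤ 1 / 2) :
    ‖ρ⁻¹ - ρ‖ ≤ 5 * Real.sin θ ∧ 1 / 2 ≤ ‖ρ‖ ^ N := by
  obtain ⟨ω, hω1, hd, hδ⟩ := exists_near_multiplier hρ hρ1 hθ hτ
  set δ := τ / Real.sin θ with hδd
  have hδ0 : 0 ≤ δ := (norm_nonneg _).trans hδ
  have hN' : (1 : ℝ) ≤ N := by exact_mod_cast hN
  have hδ2 : δ ≤ 1 / 2 := by nlinarith
  have hδs : δ ≤ Real.sin θ := by rw [hδd, div_le_iff₀ hθ]; nlinarith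
  have hlow : 1 - δ ≤ ‖ρ‖ := by
    have := norm_sub_norm_le ω ρ
    rw [norm_sub_rev, hω1] at this
    linarith
  have hω0 : ω ≠ 0 := norm_ne_zero_iff.mp (by rw [hω1]; exact one_ne_zero)
  constructor
  · have e : ρ⁻¹ - ω⁻¹ = (ω - ρ) * (ρ⁻¹ * ω⁻¹) := by field_simp
    have h1 : ‖ρ⁻¹ - ω⁻¹‖ ≤ 2 * δ := by
      rw [e, norm_mul, norm_mul, norm_inv, norm_inv, hω1, inv_one, mul_one, norm_sub_rev, mul_comm]
      have : ‖ρ‖⁻¹ ≤ 2 := by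
        rw [inv_le_comm₀ (norm_pos_iff.mpr hρ) two_pos]
        linarith
      exact mul_le_mul this hδ (norm_nonneg _) two_pos.le
    have h2 : ‖ρ⁻¹ - ρ‖ ≤ ‖ρ⁻¹ - ω⁻¹‖ + ‖ω⁻¹ - ω‖ + ‖ρ - ω‖ := by
      rw [norm_sub_rev ρ ω]
      refine le_trans (le_of_eq ?_) (norm_add₃_le (a := ρ⁻¹ - ω⁻¹) (b := ω⁻¹ - ω) (c := ω - ρ))
      congr 1; ring
    linarith
  · have hb := one_add_mul_le_pow (a := -δ) (by linarith) N
    refine le_trans ?_ (hb.trans (pow_le_pow_left₀ (by linarith) (by linarith) N))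
    linarith

section Band

variable {q : ℕ} [NeZero q] {V : ℤ → ℝ}

/-- The energy determines `2 cos qκ = Δ(λ_j(κ))`, and cosine is injective on `[0, π]`. Positive
bandwidth and strict monotonicity of each band function follow. -/
theorem eigval_injOn (hV : Function.Periodic V (q : ℤ)) (j : Fin q) :
    Set.InjOn (eigval q V j) (Set.Icc 0 (Real.pi / q)) := by
  have hq : (0 : ℝ) < q := by exact_mod_cast Nat.pos_of_ne_zero (NeZero.ne q)
  intro κ hκ κ' hκ' h
  have h1 := eval_discr_eigval hV j κ
  rw [h, eval_discr_eigval hV j κ'] at h1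
  have h2 : Real.cos (q * κ') = Real.cos (q * κ) := by
    have := Complex.ofReal_injective h1
    linarith
  have hm : ∀ x ∈ Set.Icc 0 (Real.pi / q), (q : ℝ) * x ∈ Set.Icc 0 Real.pi := fun x hx =>
    ⟨mul_nonneg hq.le hx.1, by rw [mul_comm]; exact (le_div_iff₀ hq).mp hx.2⟩
  exact (mul_left_cancel₀ hq.ne' (Real.injOn_cos (hm _ hκ') (hm _ hκ) h2)).symm

theorem pi_div_pos (q : ℕ) [NeZero q] : 0 < Real.pi / q :=
  div_pos Real.pi_pos (by exact_mod_cast Nat.pos_of_ne_zero (NeZero.ne q))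

theorem bandwidth_pos (hV : Function.Periodic V (q : ℤ)) (j : Fin q) : 0 < bandwidth q V j := by
  have hp := pi_div_pos q
  refine abs_pos.mpr (sub_ne_zero.mpr fun h => ?_)
  exact hp.ne' (eigval_injOn hV j ⟨hp.le, le_rfl⟩ ⟨le_rfl, hp.le⟩ h)

/-- The band as a closed interval, whose interior comes from interior quasimomenta. -/
theorem exists_band_interval (hV : Function.Periodic V (q : ℤ)) (j : Fin q) :
    ∃ a b : ℝ, b - a = bandwidth q V j ∧
      (∀ κ ∈ Set.Ioo 0 (Real.pi / q), eigval q V j κ ∈ Set.Ioo a b) ∧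
      (∀ E ∈ Set.Icc a b, ∃ κ ∈ Set.Icc 0 (Real.pi / q), eigval q V j κ = E) ∧
      (∀ E ∈ Set.Ioo a b, ∃ κ ∈ Set.Ioo 0 (Real.pi / q), eigval q V j κ = E) := by
  have hp := pi_div_pos q
  have hc := (continuous_eigval q V j).continuousOn (s := Set.Icc 0 (Real.pi / q))
  have h0 : (0 : ℝ) ∈ Set.Icc 0 (Real.pi / q) := ⟨le_rfl, hp.le⟩
  have h1 : Real.pi / q ∈ Set.Icc 0 (Real.pi / q) := ⟨hp.le, le_rfl⟩
  rcases hc.strictMonoOn_of_injOn_Icc' hp.le (eigval_injOn hV j) with hm | hm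
  · have hlt := hm h0 h1 hp
    refine ⟨eigval q V j 0, eigval q V j (Real.pi / q), ?_, ?_, ?_, ?_⟩
    · rw [bandwidth, abs_of_pos (sub_pos.mpr hlt)]
    · intro κ hκ
      have hκ' := Set.Ioo_subset_Icc_self hκ
      exact ⟨hm h0 hκ' hκ.1, hm hκ' h1 hκ.2⟩
    · intro E hE
      exact intermediate_value_Icc hp.le hc hE
    · intro E hE
      exact intermediate_value_Ioo hp.le hc hE
  · have hlt := hm h0 h1 hp
    refine ⟨eigval q V j (Real.pi / q), eigval q V j 0, ?_, ?_, ?_, ?_⟩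
    · rw [bandwidth, abs_of_neg (sub_neg.mpr hlt), neg_sub]
    · intro κ hκ
      have hκ' := Set.Ioo_subset_Icc_self hκ
      exact ⟨hm hκ' h1 hκ.2, hm h0 hκ' hκ.1⟩
    · intro E hE
      exact intermediate_value_Icc' hp.le hc hE
    · intro E hE
      exact intermediate_value_Ioo' hp.le hc hE

/-- The quasimomentum as a function of the energy. -/
noncomputable def quasimomentum (q : ℕ) (V : ℤ → ℝ) (E : ℝ) : ℝ :=
  Real.arccos (((discr q V).eval (E : ℂ)).re / 2) / q

theorem quasimomentum_eigval (hV : Function.Periodic V (q : ℤ)) (j : Fin q) {κ : ℝ}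
    (hκ : κ ∈ Set.Icc 0 (Real.pi / q)) : quasimomentum q V (eigval q V j κ) = κ := by
  have hq : (0 : ℝ) < q := by exact_mod_cast Nat.pos_of_ne_zero (NeZero.ne q)
  rw [quasimomentum, eval_discr_eigval hV, Complex.ofReal_re, mul_div_cancel_left₀ _ two_ne_zero,
    Real.arccos_cos (mul_nonneg hq.le hκ.1) (by rw [mul_comm]; exact (le_div_iff₀ hq).mp hκ.2),
    mul_div_cancel_left₀ _ hq.ne']

theorem sin_pos_of_mem {κ : ℝ} (hκ : κ ∈ Set.Ioo 0 (Real.pi / q)) : 0 < Real.sin (q * κ) := by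
  have hq : (0 : ℝ) < q := by exact_mod_cast Nat.pos_of_ne_zero (NeZero.ne q)
  refine Real.sin_pos_of_pos_of_lt_pi (mul_pos hq hκ.1) ?_
  rw [mul_comm]
  exact (lt_div_iff₀ hq).mp hκ.2

/-- Differentiate `Δ(E) = 2 cos(q k(E))`; at interior `κ` the cosine is not `±1`, so `arccos` is
differentiable there. -/
theorem hasDerivAt_quasimomentum (hV : Function.Periodic V (q : ℤ)) (j : Fin q) {κ : ℝ}
    (hκ : κ ∈ Set.Ioo 0 (Real.pi / q)) :
    HasDerivAt (quasimomentum q V) (-((derivative (discr q V)).eval (eigval q V j κ : ℂ)).re /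
      (2 * q * Real.sin (q * κ))) (eigval q V j κ) := by
  have hq : (0 : ℝ) < q := by exact_mod_cast Nat.pos_of_ne_zero (NeZero.ne q)
  have hs := sin_pos_of_mem hκ
  have hval : ((discr q V).eval (eigval q V j κ : ℂ)).re / 2 = Real.cos (q * κ) := by
    rw [eval_discr_eigval hV, Complex.ofReal_re, mul_div_cancel_left₀ _ two_ne_zero]
  have hsq := Real.sin_sq_add_cos_sq (q * κ)
  have h1 := ((discr q V).hasDerivAt (eigval q V j κ : ℂ)).real_of_complex
  have h2 := h1.div_const 2
  have hne1 : ((discr q V).eval (eigval q V j κ : ℂ)).re / 2 ≠ -1 := by rw [hval]; nlinarith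
  have hne2 : ((discr q V).eval (eigval q V j κ : ℂ)).re / 2 ≠ 1 := by rw [hval]; nlinarith
  have h3 := (HasDerivAt.comp (h₂ := Real.arccos)
    (h := fun x : ℝ => ((discr q V).eval (x : ℂ)).re / 2) (eigval q V j κ)
    (Real.hasDerivAt_arccos hne1 hne2) h2).div_const (q : ℝ)
  convert! h3 using 1
  rw [hval, show 1 - Real.cos (q * κ) ^ 2 = Real.sin (q * κ) ^ 2 by linarith,
    Real.sqrt_sq hs.le]
  field_simp

theorem abs_deriv_quasimomentum_mul_le (hV : Function.Periodic V (q : ℤ)) (j : Fin q) {κ : ℝ}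
    (hκ : κ ∈ Set.Ioo 0 (Real.pi / q)) :
    |deriv (quasimomentum q V) (eigval q V j κ)| * (2 * q * Real.sin (q * κ)) ≤
      ‖(derivative (discr q V)).eval (eigval q V j κ : ℂ)‖ := by
  have hq : (0 : ℝ) < q := by exact_mod_cast Nat.pos_of_ne_zero (NeZero.ne q)
  have hs := sin_pos_of_mem hκ
  have hpos : 0 < 2 * q * Real.sin (q * κ) := by positivity
  rw [(hasDerivAt_quasimomentum hV j hκ).deriv, abs_div, abs_neg, abs_of_pos hpos,
    div_mul_cancel₀ _ hpos.ne']
  exact Complex.abs_re_le_norm _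

/-- The discriminant varies slowly on the scale of a band. -/
theorem norm_eval_discr_sub_le (hV : Function.Periodic V (q : ℤ)) (j : Fin q) {κ ε : ℝ}
    (hκ : κ ∈ Set.Ioo 0 (Real.pi / q)) (hε : 0 < ε)
    (hε1 : ε < bandwidth q V j / (16 * q ^ 2)) :
    ‖(discr q V).eval ((eigval q V j κ : ℂ) + Complex.I * ε) - ((2 * Real.cos (q * κ) : ℝ) : ℂ)‖
      ≤ 96 * q ^ 2 / bandwidth q V j * ε := by
  obtain ⟨a, b, hab, hin, hsurj, -⟩ := exists_band_interval hV j
  have hℓ := bandwidth_pos hV j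
  have hn : ‖(eigval q V j κ : ℂ) + Complex.I * ε - (eigval q V j κ : ℂ)‖ = ε := by
    rw [add_sub_cancel_left, norm_mul, Complex.norm_I, one_mul, Complex.norm_real,
      Real.norm_of_nonneg hε.le]
  have hq : 1 ≤ q := Nat.one_le_iff_ne_zero.mpr (NeZero.ne q)
  -- On the band `Δ = 2 cos qκ'`, whence the bound `M = 2` and the constant `96 = 48 · 2`.
  have h := norm_eval_sub_eval_le_of_near_interval (P := discr q V) (M := 2)
    hq (natDegree_discr hq V).le (a := a) (b := b)
    (by linarith) (fun x hx => ?_) (Set.Ioo_subset_Icc_self (hin κ hκ))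
    (z := (eigval q V j κ : ℂ) + Complex.I * ε) (by rwa [hn, hab])
  · rw [hn, hab, eval_discr_eigval hV] at h
    refine h.trans_eq ?_
    ring
  · obtain ⟨κ', -, rfl⟩ := hsurj x hx
    rw [eval_discr_eigval hV, Complex.norm_real, Real.norm_eq_abs, abs_mul, abs_two]
    have := Real.abs_cos_le_one (q * κ')
    linarith

end Band

/-- The energy density `|G(nq, 0; z)|² + |G(nq + 1, 1; z)|²` of the transition probability. -/
noncomputable def energyDensity (H : L2Z →L[ℂ] L2Z) (T : ℝ) (n : ℤ) (E : ℝ) : ℝ :=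
  ‖laplaceVec H 0 (E + Complex.I * (T⁻¹ : ℝ)) n‖ ^ 2
    + ‖laplaceVec H 1 (E + Complex.I * (T⁻¹ : ℝ)) (n + 1)‖ ^ 2

/-- A pointwise lower bound for the energy density on a band. -/
theorem energyDensity_lower_bound {q : ℕ} [NeZero q] {V : ℤ → ℝ}
    (hV : Function.Periodic V (q : ℤ)) (j : Fin q) {κ η T : ℝ} {N : ℕ} (hN : 1 ≤ N)
    (hκ : κ ∈ Set.Ioo 0 (Real.pi / q)) (hsin : 1 / (2 * q) ≤ Real.sin (q * κ)) (hη : 0 < η)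
    (hw : η / q ≤ weight q V j κ) (hT : 0 < T)
    (hNT : N * (1000 * (q : ℝ) ^ 4) ≤ bandwidth q V j * T) :
    η ^ 2 / 50 * deriv (quasimomentum q V) (eigval q V j κ) ^ 2 ≤
      energyDensity (periodicOp q V hV) T (N * q) (eigval q V j κ) := by
  set E := eigval q V j κ with hE
  set ℓ := bandwidth q V j with hℓd
  have hℓ : 0 < ℓ := bandwidth_pos hV j
  have hqn : 0 < q := Nat.pos_of_ne_zero (NeZero.ne q)
  have hq : (1 : ℝ) ≤ q := by exact_mod_cast hqn
  have hN' : (1 : ℝ) ≤ N := by exact_mod_cast hN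
  have hs := sin_pos_of_mem hκ
  set s := Real.sin (q * κ) with hsd
  have hε : 0 < T⁻¹ := inv_pos.mpr hT
  have hNε : N * T⁻¹ ≤ ℓ / (1000 * (q : ℝ) ^ 4) := by
    rw [le_div_iff₀ (by positivity), mul_right_comm, ← div_eq_mul_inv, div_le_iff₀ hT]
    exact hNT
  have hε1 : T⁻¹ ≤ ℓ / (1000 * (q : ℝ) ^ 4) := le_trans (by nlinarith) hNε
  have hq24 : (q : ℝ) ^ 2 ≤ (q : ℝ) ^ 4 := pow_le_pow_right₀ hq (by norm_num)
  have hε2 : T⁻¹ < ℓ / (16 * q ^ 2) := by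
    refine hε1.trans_lt (div_lt_div_of_pos_left hℓ (by positivity) ?_)
    have : (0 : ℝ) < (q : ℝ) ^ 2 := by positivity
    linarith
  have him : 0 < ((E : ℂ) + Complex.I * (T⁻¹ : ℝ)).im := by simp; exact hT
  obtain ⟨ρ, hρ, hρ1, hρz⟩ := exists_add_inv_eq ((discr q V).eval ((E : ℂ) + Complex.I * (T⁻¹ : ℝ)))
  have hτ := norm_eval_discr_sub_le hV j hκ hε hε2
  rw [← hE, ← hρz] at hτ
  have hτval : 96 * q ^ 2 / ℓ * T⁻¹ ≤ 1 / (4 * (q : ℝ) ^ 2) := by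
    calc 96 * q ^ 2 / ℓ * T⁻¹ ≤ 96 * q ^ 2 / ℓ * (ℓ / (1000 * (q : ℝ) ^ 4)) := by gcongr
      _ = 96 / 1000 / (q : ℝ) ^ 2 := by field_simp
      _ ≤ 1 / 4 / (q : ℝ) ^ 2 := div_le_div_of_nonneg_right (by norm_num) (by positivity)
      _ = _ := by field_simp
  have hs2 : 1 / (4 * (q : ℝ) ^ 2) ≤ s ^ 2 := by
    calc 1 / (4 * (q : ℝ) ^ 2) = (1 / (2 * q)) ^ 2 := by field_simp; norm_num
      _ ≤ s ^ 2 := by gcongr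
  -- The margin `1000` is for this step: `96q²` from the discriminant and `2q` from `1/s` total
  -- `192q³`, against `1000q⁴`.
  have hτ2 : N * (96 * q ^ 2 / ℓ * T⁻¹ / s) ≤ 1 / 2 := by
    have hsi : 1 / s ≤ 2 * q := by
      rw [div_le_iff₀ hs]
      rw [div_le_iff₀ (by positivity)] at hsin
      linarith
    calc N * (96 * q ^ 2 / ℓ * T⁻¹ / s) = 96 * q ^ 2 / ℓ * (N * T⁻¹) * (1 / s) := by ring
      _ ≤ 96 * q ^ 2 / ℓ * (ℓ / (1000 * (q : ℝ) ^ 4)) * (2 * q) := by gcongr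
      _ = 192 / 1000 * (1 / q) := by field_simp; norm_num
      _ ≤ 192 / 1000 * 1 := by gcongr; rw [div_le_one (by positivity)]; exact hq
      _ ≤ 1 / 2 := by norm_num
  obtain ⟨hb1, hb2⟩ := multiplier_bounds hN hρ hρ1 hs hτ (hτval.trans hs2) hτ2
  set u0 := laplaceVec (periodicOp q V hV) 0 ((E : ℂ) + Complex.I * (T⁻¹ : ℝ)) with hu0
  set u1 := laplaceVec (periodicOp q V hV) 1 ((E : ℂ) + Complex.I * (T⁻¹ : ℝ)) with hu1
  have hs0 := laplaceVec_solves hV him 0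
  have hs1 := laplaceVec_solves hV him 1
  have hc1 : ‖-Complex.I‖ = 1 := by simp
  have hd0 := hs0.decay_right hqn hV (tendsto_cofinite_zero u0) hρ hρ1 hρz le_rfl N
  have hd1 := hs1.decay_right hqn hV (tendsto_cofinite_zero u1) hρ hρ1 hρz le_rfl N
  have hg0 := hs0.green_lower_bound hV hε hκ (tendsto_cofinite_zero u0) hc1 hρ hρ1 hρz
    (i := 0) (n₀ := 0) (by simp)
  have hg1 := hs1.green_lower_bound hV hε hκ (tendsto_cofinite_zero u1) hc1 hρ hρ1 hρz
    -- Site `1` is index `1 mod q` in block `1 / q`; the block is nonzero only for `q = 1`.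
    (i := 1) (n₀ := 1 / (q : ℤ)) (by
      rw [Fin.val_one']
      push_cast
      exact Int.emod_add_ediv_mul _ _)
  rw [zero_add] at hd0
  rw [add_comm (1 : ℤ)] at hd1
  simp only [← hu0, ← hu1] at hd0 hd1 hg0 hg1
  set D := ‖(derivative (discr q V)).eval (E : ℂ)‖ with hD
  have hk := abs_deriv_quasimomentum_mul_le hV j hκ
  rw [← hE, ← hD, ← hsd] at hk
  set k' := deriv (quasimomentum q V) E with hk'
  -- The factors `s` on the two sides cancel. Halving by `‖ρ‖^N` turns `2/5` into `1/5`, and `(x +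
  -- y)² ≤ 2(x² + y²)` then gives the constant `1/50`.
  have hsum : η * |k'| * (2 * s) ≤ (‖u0 0‖ + ‖u1 1‖) * (5 * s) := by
    calc η * |k'| * (2 * s) = η / q * (|k'| * (2 * q * s)) := by field_simp
      _ ≤ weight q V j κ * D := mul_le_mul hw hk (by positivity) ((by positivity : 0 ≤ η / q).trans hw)
      _ ≤ ‖u0 0‖ * ‖ρ⁻¹ - ρ‖ + ‖u1 1‖ * ‖ρ⁻¹ - ρ‖ := by
        rw [weight, add_mul]; exact add_le_add hg0 hg1
      _ = (‖u0 0‖ + ‖u1 1‖) * ‖ρ⁻¹ - ρ‖ := by ring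
      _ ≤ _ := mul_le_mul_of_nonneg_left hb1 (by positivity)
  have hsum2 : η * |k'| / 5 ≤ ‖u0 (N * q)‖ + ‖u1 (N * q + 1)‖ := by
    have h1 : η * |k'| * 2 ≤ (‖u0 0‖ + ‖u1 1‖) * 5 := by
      refine le_of_mul_le_mul_right ?_ hs
      linarith
    rw [hd0, hd1, norm_mul, norm_mul, norm_pow, ← mul_add]
    have : 1 / 2 * (‖u0 0‖ + ‖u1 1‖) ≤ ‖ρ‖ ^ N * (‖u0 0‖ + ‖u1 1‖) :=
      mul_le_mul_of_nonneg_right hb2 (by positivity)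
    linarith
  have hsq := pow_le_pow_left₀ (by positivity) hsum2 2
  rw [div_pow, mul_pow, sq_abs] at hsq
  rw [energyDensity]
  have := sq_nonneg (‖u0 (N * q)‖ - ‖u1 (N * q + 1)‖)
  nlinarith

end PeriodicSchrodinger


/-! ### Choice of the band and integration over it -/

open Polynomial MeasureTheory Filter

namespace PeriodicSchrodinger

variable {q : ℕ} [NeZero q] {V : ℤ → ℝ}

theorem weight_nonneg (j : Fin q) (κ : ℝ) : 0 ≤ weight q V j κ := by
  rw [weight]; positivity

theorem sum_weight_le_two (q : ℕ) [NeZero q] (V : ℤ → ℝ) (κ : ℝ) :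
    ∑ j : Fin q, weight q V j κ ≤ 2 := by
  have h : ∀ i : Fin q, ∑ j : Fin q,
      ‖inner ℂ (eigvec q V j κ) (EuclideanSpace.single i (1 : ℂ))‖ ^ 2 ≤ 1 := fun i => by
    refine ((eigvec_orthonormal q V κ).sum_inner_products_le _).trans ?_
    rw [PiLp.norm_single, norm_one, one_pow]
  simp only [weight, Finset.sum_add_distrib]
  linarith [h 0, h 1]

theorem floquetMeasure_apply (κ : ℝ) {I : Set ℝ} (hI : MeasurableSet I) :
    floquetMeasure q V κ I = ∑ j : Fin q, ENNReal.ofReal (weight q V j κ) *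
      I.indicator 1 (eigval q V j κ) := by
  simp [floquetMeasure, Measure.dirac_apply' _ hI]

/-- The total mass is at most `2`, by Bessel's inequality at `e_0` and `e_1`. The bound lets `η` be
absorbed in the range allowed for `n`. -/
theorem lt_two_of_lt_floquetMeasure {κ η : ℝ} {I : Set ℝ} (hI : MeasurableSet I)
    (h : ENNReal.ofReal η < floquetMeasure q V κ I) : η < 2 := by
  have h1 : floquetMeasure q V κ I ≤ ENNReal.ofReal 2 := by
    rw [floquetMeasure_apply κ hI]
    calc _ ≤ ∑ j : Fin q, ENNReal.ofReal (weight q V j κ) := by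
          refine Finset.sum_le_sum fun j _ => mul_le_of_le_one_right' ?_
          exact Set.indicator_le_self' (fun _ _ => zero_le) _
      _ = ENNReal.ofReal (∑ j : Fin q, weight q V j κ) :=
          (ENNReal.ofReal_sum_of_nonneg fun j _ => weight_nonneg j κ).symm
      _ ≤ _ := ENNReal.ofReal_le_ofReal (sum_weight_le_two q V κ)
  exact (ENNReal.ofReal_lt_ofReal_iff two_pos).mp (h.trans_le h1)

theorem exists_weight_of_lt_floquetMeasure {κ η : ℝ} {I : Set ℝ} (hI : MeasurableSet I)
    (h : ENNReal.ofReal η < floquetMeasure q V κ I) :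
    ∃ j : Fin q, eigval q V j κ ∈ I ∧ η / q ≤ weight q V j κ := by
  have hq : (0 : ℝ) < q := by exact_mod_cast Nat.pos_of_ne_zero (NeZero.ne q)
  by_contra! hcon
  refine absurd h (not_lt.mpr ?_)
  rw [floquetMeasure_apply κ hI]
  calc _ ≤ ∑ _j : Fin q, ENNReal.ofReal (η / q) := by
        refine Finset.sum_le_sum fun j _ => ?_
        by_cases hj : eigval q V j κ ∈ I
        · rw [Set.indicator_of_mem hj, Pi.one_apply, mul_one]
          exact ENNReal.ofReal_le_ofReal (hcon j hj).le
        · rw [Set.indicator_of_notMem hj, mul_zero]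
          exact zero_le
    _ = ENNReal.ofReal η := by
        rw [Finset.sum_const, Finset.card_univ, Fintype.card_fin, nsmul_eq_mul,
          ← ENNReal.ofReal_natCast, ← ENNReal.ofReal_mul hq.le, mul_div_cancel₀ _ hq.ne']

/-- Quasimomenta with `sin(qκ)` of order at least `1/q`. -/
def bulk (q : ℕ) : Set ℝ := {κ | κ ∈ Set.Ioo 0 (Real.pi / q) ∧ 1 / (2 * q) ≤ Real.sin (q * κ)}

/-- By Jordan's inequality `sin x ≥ 2x/π`, the condition on the sine can fail only within `r =
π/(4q²)` of an endpoint. -/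
theorem volume_diff_bulk_le (q : ℕ) [NeZero q] :
    volume (Set.Ioo 0 (Real.pi / q) \ bulk q) ≤ ENNReal.ofReal (Real.pi / (2 * q ^ 2)) := by
  have hpi := Real.pi_pos
  have hq1 : 1 ≤ q := Nat.one_le_iff_ne_zero.mpr (NeZero.ne q)
  have hq : (1 : ℝ) ≤ q := by exact_mod_cast hq1
  set r := Real.pi / (4 * (q : ℝ) ^ 2) with hr
  have hr0 : 0 < r := by positivity
  have hqr : q * r = Real.pi / (4 * q) := by rw [hr]; field_simp
  have hsub : Set.Ioo 0 (Real.pi / q) \ bulk q ⊆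
      Set.Ioo 0 r ∪ Set.Ioo (Real.pi / q - r) (Real.pi / q) := by
    rintro κ ⟨hκ, hb⟩
    by_contra hcon
    simp only [Set.mem_union, Set.mem_Ioo, not_or, not_and, not_lt] at hcon
    have h1 : r ≤ κ := hcon.1 hκ.1
    have h2 : κ ≤ Real.pi / q - r := by
      by_contra! h
      exact absurd (hcon.2 h) (not_le.mpr hκ.2)
    have hθ1 : q * r ≤ q * κ := by gcongr
    have hθ2 : q * r ≤ Real.pi - q * κ := by
      have := mul_le_mul_of_nonneg_left h2 (by positivity : (0 : ℝ) ≤ q)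
      rw [mul_sub, mul_div_cancel₀ _ (by positivity)] at this
      linarith
    have hval : 2 / Real.pi * (q * r) = 1 / (2 * q) := by rw [hqr]; field_simp; norm_num
    refine hb ⟨hκ, ?_⟩
    rw [← hval]
    have hp : 0 ≤ 2 / Real.pi := by positivity
    have hqr0 : 0 < q * r := by positivity
    rcases le_total (q * κ) (Real.pi / 2) with h | h
    · exact (mul_le_mul_of_nonneg_left hθ1 hp).trans (Real.mul_le_sin (by linarith) h)
    · rw [← Real.sin_pi_sub]
      exact (mul_le_mul_of_nonneg_left hθ2 hp).trans (Real.mul_le_sin (by linarith) (by linarith))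
  refine (measure_mono hsub).trans ((measure_union_le _ _).trans ?_)
  rw [Real.volume_Ioo, Real.volume_Ioo, ← ENNReal.ofReal_add (by linarith) (by linarith)]
  refine ENNReal.ofReal_le_ofReal (le_of_eq ?_)
  rw [hr]
  field_simp
  ring

/-- Some band carries a share of at least `1/q` of a cover of the quasimomenta, up to the
neighbourhoods of the band edges. -/
theorem exists_large_piece (K : Fin q → Set ℝ)
    (hK : ∀ κ ∈ Set.Ioo 0 (Real.pi / q), ∃ j, κ ∈ K j) :
    ∃ j, ENNReal.ofReal (Real.pi / (2 * q ^ 2)) ≤ volume (K j ∩ bulk q) := by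
  have hpi := Real.pi_pos
  have hq : (0 : ℝ) < q := by exact_mod_cast Nat.pos_of_ne_zero (NeZero.ne q)
  have h1 : ∃ j, ENNReal.ofReal (Real.pi / q ^ 2) ≤
      volume (K j ∩ Set.Ioo 0 (Real.pi / q)) := by
    -- Only subadditivity is used, so the sets `K j` need not be measurable; this matters because
    -- the eigenvectors are chosen arbitrarily for each `κ`.
    by_contra! hcon
    have hsub : Set.Ioo 0 (Real.pi / q) ⊆ ⋃ j, K j ∩ Set.Ioo 0 (Real.pi / q) := fun κ hκ => by
      obtain ⟨j, hj⟩ := hK κ hκ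
      exact Set.mem_iUnion.mpr ⟨j, hj, hκ⟩
    have h2 := (measure_mono hsub).trans (measure_iUnion_fintype_le volume _)
    have h3 : ∑ j, volume (K j ∩ Set.Ioo 0 (Real.pi / q)) <
        ∑ _j : Fin q, ENNReal.ofReal (Real.pi / q ^ 2) :=
      ENNReal.sum_lt_sum_of_nonempty Finset.univ_nonempty fun j _ => hcon j
    rw [Finset.sum_const, Finset.card_univ, Fintype.card_fin, nsmul_eq_mul,
      ← ENNReal.ofReal_natCast, ← ENNReal.ofReal_mul hq.le] at h3
    rw [Real.volume_Ioo, sub_zero] at h2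
    have e : (q : ℝ) * (Real.pi / q ^ 2) = Real.pi / q := by field_simp
    rw [e] at h3
    exact absurd h3 (not_lt.mpr h2)
  obtain ⟨j, hj⟩ := h1
  refine ⟨j, ?_⟩
  have hsub : K j ∩ Set.Ioo 0 (Real.pi / q) ⊆
      (K j ∩ bulk q) ∪ (Set.Ioo 0 (Real.pi / q) \ bulk q) := fun κ hκ => by
    by_cases hb : κ ∈ bulk q
    · exact Or.inl ⟨hκ.1, hb⟩
    · exact Or.inr ⟨hκ.2, hb⟩
  have h2 := (hj.trans (measure_mono hsub)).trans (measure_union_le _ _)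
  have h3 := h2.trans (add_le_add_right (volume_diff_bulk_le q) _)
  have e : Real.pi / (q : ℝ) ^ 2 = Real.pi / (2 * q ^ 2) + Real.pi / (2 * q ^ 2) := by
    field_simp; ring
  rw [e, ENNReal.ofReal_add (by positivity) (by positivity)] at h3
  exact (ENNReal.add_le_add_iff_right ENNReal.ofReal_ne_top).mp h3

/-- If `h ≥ A k'²` on a subset of an interval of length `ℓ` whose image under the injective
function `k` has outer measure at least `m`, then `∫ h ≥ A m² / ℓ`. -/
theorem integral_ge_of_image {h k : ℝ → ℝ} {a b A m c d : ℝ} (hab : a < b) (hA : 0 ≤ A)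
    (hm : 0 ≤ m) (hh : Integrable h) (hhc : Continuous h) (hh0 : ∀ E, 0 ≤ h E)
    (hk : ∀ E ∈ Set.Ioo a b, DifferentiableAt ℝ k E) (hinj : Set.InjOn k (Set.Ioo a b))
    (hkb : ∀ E ∈ Set.Ioo a b, k E ∈ Set.Icc c d)
    {K : Set ℝ} (hK : ENNReal.ofReal m ≤ volume K)
    (hKi : ∀ κ ∈ K, ∃ E ∈ Set.Ioo a b, k E = κ ∧ A * deriv k E ^ 2 ≤ h E) :
    A * (m ^ 2 / (b - a)) ≤ ∫ E, h E := by
  have hℓ : 0 < b - a := sub_pos.mpr hab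
  -- Taking all energies with the pointwise inequality gives a measurable set whose image contains
  -- `K`; hence no measurability of `K` is required.
  set S : Set ℝ := Set.Ioo a b ∩ {E | A * deriv k E ^ 2 ≤ h E} with hS
  have hSm : MeasurableSet S := measurableSet_Ioo.inter
    (measurableSet_le (((measurable_deriv k).pow_const 2).const_mul A) hhc.measurable)
  have hSsub : S ⊆ Set.Ioo a b := Set.inter_subset_left
  have hder : ∀ E ∈ S, HasDerivWithinAt k (deriv k E) S E := fun E hE =>
    (hk E (hSsub hE)).hasDerivAt.hasDerivWithinAt
  have hinjS := hinj.mono hSsub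
  have himg : k '' S ⊆ Set.Icc c d := by
    rintro _ ⟨E, hE, rfl⟩
    exact hkb E (hSsub hE)
  have hfin : volume (k '' S) ≠ ⊤ := ((measure_mono himg).trans_lt measure_Icc_lt_top).ne
  have hSfin : volume S ≠ ⊤ := ((measure_mono hSsub).trans_lt measure_Ioo_lt_top).ne
  have hKsub : K ⊆ k '' S := fun κ hκ => by
    obtain ⟨E, hE, rfl, hle⟩ := hKi κ hκ
    exact ⟨E, ⟨hE, hle⟩, rfl⟩
  have hmle : m ≤ volume.real (k '' S) := by
    rw [Measure.real, ← ENNReal.ofReal_le_iff_le_toReal hfin]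
    exact hK.trans (measure_mono hKsub)
  have hvol : volume.real (k '' S) = ∫ E in S, |deriv k E| := by
    have := integral_image_eq_integral_abs_deriv_smul hSm hder hinjS fun _ => (1 : ℝ)
    simpa using this
  have hki : IntegrableOn (fun E => |deriv k E|) S := by
    have := (integrableOn_image_iff_integrableOn_abs_deriv_smul hSm hder hinjS
      fun _ => (1 : ℝ)).mp (integrableOn_const hfin)
    simpa using this
  have hSvol : volume.real S ≤ b - a := by
    have := measureReal_mono hSsub (measure_Ioo_lt_top (μ := (volume : Measure ℝ))).ne
    rwa [Real.volume_real_Ioo_of_le hab.le] at this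
  set B := m / (b - a) with hB
  have hB0 : 0 ≤ B := by positivity
  -- Cauchy–Schwarz in tangent-line form, `k'² ≥ 2B|k'| - B²`, with the optimal `B = m/(b - a)`; it
  -- needs integrability of `|k'|` only, which the area formula provides.
  have hpt : ∀ E ∈ S, A * (2 * B * |deriv k E| - B ^ 2) ≤ h E := fun E hE => by
    refine le_trans (mul_le_mul_of_nonneg_left ?_ hA) hE.2
    rw [← sq_abs (deriv k E)]
    nlinarith [sq_nonneg (|deriv k E| - B)]
  have hi2 : IntegrableOn (fun E => A * (2 * B * |deriv k E| - B ^ 2)) S :=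
    ((hki.const_mul (2 * B)).sub (integrableOn_const hSfin)).const_mul A
  have h1 : ∫ E in S, A * (2 * B * |deriv k E| - B ^ 2) ≤ ∫ E in S, h E :=
    setIntegral_mono_on hi2 hh.integrableOn hSm hpt
  have h2 : ∫ E in S, h E ≤ ∫ E, h E :=
    setIntegral_le_integral hh (Eventually.of_forall hh0)
  have h3 : ∫ E in S, A * (2 * B * |deriv k E| - B ^ 2)
      = A * (2 * B * volume.real (k '' S) - B ^ 2 * volume.real S) := by
    rw [integral_const_mul, integral_sub (hki.const_mul (2 * B)) (integrableOn_const hSfin),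
      integral_const_mul, ← hvol, setIntegral_const, smul_eq_mul]
    ring
  have h4 : m ^ 2 / (b - a) ≤ 2 * B * volume.real (k '' S) - B ^ 2 * volume.real S := by
    have e : m ^ 2 / (b - a) = 2 * B * m - B ^ 2 * (b - a) := by rw [hB]; field_simp; ring
    rw [e]
    have := mul_le_mul_of_nonneg_left hmle (by positivity : 0 ≤ 2 * B)
    have := mul_le_mul_of_nonneg_left hSvol (sq_nonneg B)
    linarith
  calc A * (m ^ 2 / (b - a)) ≤ _ := mul_le_mul_of_nonneg_left h4 hA
    _ = _ := h3.symm
    _ ≤ _ := h1.trans h2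

theorem energyDensity_continuous_integrable {H : L2Z →L[ℂ] L2Z} (hH : IsSelfAdjoint H) {T : ℝ}
    (hT : 0 < T) (n : ℤ) :
    Continuous (energyDensity H T n) ∧ Integrable (energyDensity H T n) := by
  have him : ∀ E : ℝ, 0 < ((E : ℂ) + Complex.I * (T⁻¹ : ℝ)).im := fun E => by
    simp; exact hT
  have hA := norm_inner_delta_propagator_le hH
  have e : energyDensity H T n = fun E : ℝ =>
      ‖laplace (fun t => inner ℂ (delta n) (propagator H t (delta 0)))
          (E + Complex.I * (T⁻¹ : ℝ))‖ ^ 2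
      + ‖laplace (fun t => inner ℂ (delta (n + 1)) (propagator H t (delta 1)))
          (E + Complex.I * (T⁻¹ : ℝ))‖ ^ 2 := by
    funext E
    rw [energyDensity, laplaceVec_apply hH (him E), laplaceVec_apply hH (him E)]
  rw [e]
  exact ⟨((continuous_laplace (continuous_inner_propagator _ _) (hA n 0) hT).norm.pow 2).add
      ((continuous_laplace (continuous_inner_propagator _ _) (hA (n + 1) 1) hT).norm.pow 2),
    (integrable_norm_sq_laplace (continuous_inner_propagator _ _) (hA n 0) hT).add
      (integrable_norm_sq_laplace (continuous_inner_propagator _ _) (hA (n + 1) 1) hT)⟩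

/-- The transition probability is bounded below by the contribution of a single band. -/
theorem abelProb_lower_bound (hV : Function.Periodic V (q : ℤ)) (j : Fin q) {η T : ℝ} {N : ℕ}
    (hN : 1 ≤ N) (hη : 0 < η) (hT : 0 < T)
    (hNT : N * (1000 * (q : ℝ) ^ 4) ≤ bandwidth q V j * T) {K : Set ℝ}
    (hK : ∀ κ ∈ K, η / q ≤ weight q V j κ)
    (hvol : ENNReal.ofReal (Real.pi / (2 * q ^ 2)) ≤ volume (K ∩ bulk q)) :
    (Real.pi * T)⁻¹ * (η ^ 2 / 50 * ((Real.pi / (2 * q ^ 2)) ^ 2 / bandwidth q V j)) ≤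
      abelProb (periodicOp q V hV) T (N * q) := by
  have hpi := Real.pi_pos
  have hH : IsSelfAdjoint (periodicOp q V hV) := schrodinger_isSelfAdjoint _ _
  rw [abelProb_eq hH hT]
  refine mul_le_mul_of_nonneg_left ?_ (by positivity)
  obtain ⟨a, b, hab, hin, -, hsurj⟩ := exists_band_interval hV j
  have hℓ := bandwidth_pos hV j
  rw [← hab]
  obtain ⟨hc, hi⟩ := energyDensity_continuous_integrable hH hT ((N : ℤ) * q)
  refine integral_ge_of_image (h := energyDensity (periodicOp q V hV) T (N * q))
    (k := quasimomentum q V) (c := 0) (d := Real.pi / q) (by linarith) (by positivity)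
    (by positivity) hi hc (fun E => by rw [energyDensity]; positivity) ?_ ?_ ?_ hvol ?_
  · intro E hE
    obtain ⟨κ, hκ, rfl⟩ := hsurj E hE
    exact (hasDerivAt_quasimomentum hV j hκ).differentiableAt
  · intro E hE E' hE' h
    obtain ⟨κ, hκ, rfl⟩ := hsurj E hE
    obtain ⟨κ', hκ', rfl⟩ := hsurj E' hE'
    rw [quasimomentum_eigval hV j (Set.Ioo_subset_Icc_self hκ),
      quasimomentum_eigval hV j (Set.Ioo_subset_Icc_self hκ')] at h
    rw [h]
  · intro E hE
    obtain ⟨κ, hκ, rfl⟩ := hsurj E hE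
    rw [quasimomentum_eigval hV j (Set.Ioo_subset_Icc_self hκ)]
    exact Set.Ioo_subset_Icc_self hκ
  · rintro κ ⟨hκK, hκ, hsin⟩
    exact ⟨eigval q V j κ, hin κ hκ, quasimomentum_eigval hV j (Set.Ioo_subset_Icc_self hκ),
      energyDensity_lower_bound hV j hN hκ hsin hη (hK κ hκK) hT hNT⟩

end PeriodicSchrodinger

/-! ### Conclusion: the constants -/

theorem mainTheorem2 :
    ∃ c c₁ C : ℝ, 0 < c ∧ 0 < c₁ ∧ 0 < C ∧
      ∀ (q : ℕ) [NeZero q] (V : ℤ → ℝ) (hV : Function.Periodic V (q : ℤ))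
        (I : Set ℝ) (_ : I.OrdConnected) (η : ℝ) (_ : 0 < η)
        (_ : ENNReal.ofReal η <
          ⨅ κ ∈ Set.Icc (0 : ℝ) (Real.pi / q), PeriodicSchrodinger.floquetMeasure q V κ I),
        ∃ j : Fin q, (PeriodicSchrodinger.band q V j ∩ I).Nonempty ∧
          0 < PeriodicSchrodinger.bandwidth q V j ∧
          ∀ T : ℝ,
            C / c₁ * (η ^ 2)⁻¹ * (q : ℝ) ^ 8 * (PeriodicSchrodinger.bandwidth q V j ^ 2)⁻¹ + 1 < T →
            ∀ n : ℤ,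
              C * η⁻¹ * (q : ℝ) ^ 4 * (PeriodicSchrodinger.bandwidth q V j)⁻¹ < n →
              (n : ℝ) < c₁ * η * ((q : ℝ) ^ 4)⁻¹ * PeriodicSchrodinger.bandwidth q V j * T →
              c * η ^ 2 / ((q : ℝ) ^ 6 * PeriodicSchrodinger.bandwidth q V j * T) <
                PeriodicSchrodinger.abelProb (PeriodicSchrodinger.periodicOp q V hV) T (n * q) := by
  -- Since `η < 2`, the value `c₁ = 1/2000` gives `1000 q⁴ N ≤ ℓT`. The band estimate equals
  -- `(π/200) η² / (q⁴ℓT)`, so `c = 1/200` leaves the strictness to `π > 1`. With `C = 1` the lower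
  -- thresholds serve to make `T` and `n` positive.
  refine ⟨1 / 200, 1 / 2000, 1, by norm_num, by norm_num, one_pos, ?_⟩
  intro q _ V hV I hI η hη hinf
  have hpi := Real.pi_pos
  have hqn : 1 ≤ q := Nat.one_le_iff_ne_zero.mpr (NeZero.ne q)
  have hq : (1 : ℝ) ≤ q := by exact_mod_cast hqn
  have hIm : MeasurableSet I := hI.measurableSet
  have hκ : ∀ κ ∈ Set.Icc (0 : ℝ) (Real.pi / q),
      ENNReal.ofReal η < PeriodicSchrodinger.floquetMeasure q V κ I := fun κ hκ =>
    hinf.trans_le (iInf₂_le κ hκ)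
  have hη2 : η < 2 := PeriodicSchrodinger.lt_two_of_lt_floquetMeasure hIm
    (hκ 0 ⟨le_rfl, (PeriodicSchrodinger.pi_div_pos q).le⟩)
  obtain ⟨j, hj⟩ := PeriodicSchrodinger.exists_large_piece
    (fun j : Fin q => {κ | PeriodicSchrodinger.eigval q V j κ ∈ I ∧
      η / q ≤ PeriodicSchrodinger.weight q V j κ})
    (fun κ h => PeriodicSchrodinger.exists_weight_of_lt_floquetMeasure hIm
      (hκ κ (Set.Ioo_subset_Icc_self h)))
  have hℓ := PeriodicSchrodinger.bandwidth_pos hV j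
  refine ⟨j, ?_, hℓ, ?_⟩
  · have hne : (({κ | PeriodicSchrodinger.eigval q V j κ ∈ I ∧
        η / q ≤ PeriodicSchrodinger.weight q V j κ}) ∩ PeriodicSchrodinger.bulk q).Nonempty := by
      refine MeasureTheory.nonempty_of_measure_ne_zero (μ := MeasureTheory.volume)
        (ne_of_gt (lt_of_lt_of_le ?_ hj))
      exact ENNReal.ofReal_pos.mpr (by positivity)
    obtain ⟨κ, ⟨hκI, -⟩, hκb, -⟩ := hne
    exact ⟨_, ⟨κ, Set.Ioo_subset_Icc_self hκb, rfl⟩, hκI⟩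
  · intro T hT n hn1 hn2
    set ℓ := PeriodicSchrodinger.bandwidth q V j with hℓd
    have hT0 : 0 < T := by
      have : 0 ≤ 1 / (1 / 2000) * (η ^ 2)⁻¹ * (q : ℝ) ^ 8 * (ℓ ^ 2)⁻¹ := by positivity
      linarith
    have hn0 : (0 : ℝ) < n := lt_of_le_of_lt (by positivity) hn1
    obtain ⟨N, rfl⟩ : ∃ N : ℕ, n = N := ⟨n.toNat, by
      have : 0 < n := by exact_mod_cast hn0
      omega⟩
    have hN : 1 ≤ N := by
      have : 0 < N := by exact_mod_cast hn0
      omega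
    have hNT : N * (1000 * (q : ℝ) ^ 4) ≤ ℓ * T := by
      have h1 : (N : ℝ) < 1 / 1000 * ((q : ℝ) ^ 4)⁻¹ * ℓ * T := by
        refine lt_of_lt_of_le hn2 ?_
        have : 1 / 2000 * η ≤ 1 / 1000 := by linarith
        gcongr
      have h2 : 1 / 1000 * ((q : ℝ) ^ 4)⁻¹ * ℓ * T = ℓ * T / (1000 * (q : ℝ) ^ 4) := by
        field_simp
      rw [h2, lt_div_iff₀ (by positivity)] at h1
      exact h1.le
    refine lt_of_lt_of_le ?_ (PeriodicSchrodinger.abelProb_lower_bound hV j hN hη hT0 hNT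
      (fun κ h => h.2) hj)
    rw [← hℓd]
    have e : (Real.pi * T)⁻¹ * (η ^ 2 / 50 * ((Real.pi / (2 * (q : ℝ) ^ 2)) ^ 2 / ℓ))
        = Real.pi / 200 * η ^ 2 / ((q : ℝ) ^ 4 * ℓ * T) := by
      field_simp
      norm_num
    rw [e]
    have h46 : (q : ℝ) ^ 4 ≤ (q : ℝ) ^ 6 := pow_le_pow_right₀ hq (by norm_num)
    have hpi1 : 1 < Real.pi := by linarith [Real.pi_gt_three]
    calc 1 / 200 * η ^ 2 / ((q : ℝ) ^ 6 * ℓ * T)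
        ≤ 1 / 200 * η ^ 2 / ((q : ℝ) ^ 4 * ℓ * T) := by gcongr
      _ < _ := by gcongr
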